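/- Let $n\in\mathbb N$, identify $\mathbb R^{4n}$ with $\mathbb H^n$ (with its Euclidean norm), let $M$ be a Hausdorff $C^\infty$ manifold of real dimension $4n$, and let $p\in M$. Let $\mathbb{HP}^{m}$ be the manifold of right quaternionic lines of $\mathbb H^{m+1}$, and let $Bl_0(\mathbb H^n)=\{(q,\ell)\in\mathbb H^n\times\mathbb{HP}^{n-1} : q\in \ell\}$, with the smooth structure given by the charts $(q,[a])\mapsto(a_1a_i^{-1},\dots,a_{i-1}a_i^{-1},q_i,a_{i+1}a_i^{-1},\dots,a_na_i^{-1})$ on $\{a_i\ne0\}$, $1\le i\le n$; let $\pi_1(q,\ell)=q$. A coordinate ball of $M$ at $p$ is a smooth chart $\varphi:U\to\mathbb H^n$ of $M$ with $p\in U$, $\varphi(p)=0$, whose image $\varphi(U)$ contains the closed unit ball. Given such a $\varphi$: * the blow-up $Bl_p(M)$ of $M$ at $p$ with respect to $\varphi$ is the smooth manifold obtained by gluing $M\setminus\{p\}$ and $\pi_1^{-1}(\varphi(U))\subset Bl_0(\mathbb H^n)$, where each $x\in\pi_1^{-1}(\varphi(U)\setminus\{0\})$ is identified with $\varphi^{-1}(\pi_1(x))$;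 so the point $p$ is replaced by the $\mathbb{HP}^{n-1}$ of right quaternionic lines of $T_pM\cong\mathbb H^n$; * the connected sum $M\#\mathbb{HP}^n$ along $\varphi$ is obtained from $M\setminus\varphi^{-1}(\{|x|<1\})$ and $\mathbb{HP}^n\setminus\{[1:x] : |x|<1\}$ by identifying the boundary spheres via $\varphi^{-1}(x)\sim[1:x]$, $|x|=1$; its smooth structure near the common sphere is the one obtained by gluing open collars via $\varphi^{-1}(x)\sim[1:x/|x|^2]$. Then coordinate balls of $M$ at $p$ exist and, for every coordinate ball $\varphi$ of $M$ at $p$, the connected sum $M\#\mathbb{HP}^n$ along $\varphi$ is diffeomorphic to the blow-up $Bl_p(M)$ with respect to $\varphi$. -/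

import Mathlib

open Set Topology TopologicalSpace Manifold
open scoped ContDiff Quaternion LinearAlgebra.Projectivization

/-! ## Quaternionic space, quaternionic projective space -/

/-- `ℍⁿ` with its Euclidean norm, a real vector space of dimension `4n`. -/
abbrev Hn (n : ℕ) : Type := PiLp 2 fun _ : Fin n => ℍ[ℝ]

/-- The space of right vector lines of `ℍᵐ`, which is the quaternionic projective space of
dimension `m - 1`. Right vector spaces over `ℍ` are modules over the opposite ring. -/
abbrev QP (m : ℕ) : Type := ℙ ℍ[ℝ]ᵐᵒᵖ (Hn m)

theorem contDiffAt_quaternion_inv {x : ℍ[ℝ]} (hx : x ≠ 0) :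
    ContDiffAt ℝ ∞ (fun y : ℍ[ℝ] => y⁻¹) x := by
  have h := contDiffAt_ringInverse (n := ∞) ℝ (Units.mk0 x hx)
  rwa [Ring.inverse_eq_inv'] at h

namespace QP

variable {m : ℕ}

/-- The quotient topology. -/
instance : TopologicalSpace (QP m) :=
  inferInstanceAs (TopologicalSpace (Quotient (projectivizationSetoid ℍ[ℝ]ᵐᵒᵖ (Hn m))))

theorem isQuotientMap_mk' :
    IsQuotientMap (Projectivization.mk' ℍ[ℝ]ᵐᵒᵖ : {v : Hn m // v ≠ 0} → QP m) :=
  isQuotientMap_quotient_mk'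

theorem exists_rep (x : QP m) : ∃ v hv, Projectivization.mk ℍ[ℝ]ᵐᵒᵖ v hv = x :=
  ⟨x.rep, x.rep_nonzero, x.mk_rep⟩

theorem smul_coord (t : ℍ[ℝ]ᵐᵒᵖ) (v : Hn m) (i : Fin m) : (t • v) i = v i * t.unop := rfl

theorem ne_zero_of_eq_smul {t : ℍ[ℝ]ᵐᵒᵖ} {v w : Hn m} (hv : v ≠ 0) (h : v = t • w) :
    t.unop ≠ 0 := by
  rintro ht
  apply hv
  ext1 i
  rw [h, smul_coord, ht, mul_zero]
  rfl

/-- The orthogonal projection matrix onto a line. -/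
noncomputable def projector (x : QP m) : Fin m → Fin m → ℍ[ℝ] :=
  Projectivization.lift (fun (v : {v : Hn m // v ≠ 0}) i j => (‖v.1‖ ^ 2)⁻¹ • (v.1 i * star (v.1 j)))
    (by
      rintro ⟨a, ha⟩ ⟨b, hb⟩ t h
      have ht := ne_zero_of_eq_smul ha h
      dsimp only at h
      funext i j
      have hn : ‖a‖ ^ 2 = ‖t.unop‖ ^ 2 * ‖b‖ ^ 2 := by
        simp only [h, PiLp.norm_sq_eq_of_L2, smul_coord, norm_mul, mul_pow, Finset.mul_sum]
        exact Finset.sum_congr rfl fun _ _ => mul_comm _ _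
      have ht' : t.unop * star t.unop = ((‖t.unop‖ ^ 2 : ℝ) : ℍ[ℝ]) := by
        rw [Quaternion.self_mul_star, Quaternion.normSq_eq_norm_mul_self, sq]
      have hab : a i * star (a j) = ‖t.unop‖ ^ 2 • (b i * star (b j)) := by
        rw [h, smul_coord, smul_coord, star_mul, ← mul_assoc, mul_assoc (b i), ht',
          ← Quaternion.coe_commutes, mul_assoc, Quaternion.coe_mul_eq_smul]
      rw [hab, hn, smul_smul, mul_inv, mul_right_comm, inv_mul_cancel₀, one_mul]
      exact pow_ne_zero 2 (norm_ne_zero_iff.2 ht)) x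

theorem projector_injective : Function.Injective (projector (m := m)) := by
  intro x y h
  obtain ⟨v, hv, rfl⟩ := exists_rep x
  obtain ⟨w, hw, rfl⟩ := exists_rep y
  have h' : ∀ i j, (‖v‖ ^ 2)⁻¹ • (v i * star (v j)) = (‖w‖ ^ 2)⁻¹ • (w i * star (w j)) :=
    fun i j => congrFun (congrFun h i) j
  have hs : ∑ j, star (v j) * v j = ((‖v‖ ^ 2 : ℝ) : ℍ[ℝ]) := by
    rw [PiLp.norm_sq_eq_of_L2]
    change _ = algebraMap ℝ ℍ[ℝ] (∑ j, ‖v j‖ ^ 2)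
    rw [map_sum]
    refine Finset.sum_congr rfl fun j _ => ?_
    rw [Quaternion.star_mul_self, Quaternion.normSq_eq_norm_mul_self, sq]
    rfl
  rw [Projectivization.mk_eq_mk_iff']
  refine ⟨MulOpposite.op ((‖w‖ ^ 2)⁻¹ • ∑ j, star (w j) * v j), ?_⟩
  ext1 i
  rw [smul_coord, MulOpposite.unop_op, mul_smul_comm, Finset.mul_sum, Finset.smul_sum]
  have : ∀ j, (‖w‖ ^ 2)⁻¹ • (w i * (star (w j) * v j)) =
      (‖v‖ ^ 2)⁻¹ • (v i * (star (v j) * v j)) := fun j => by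
    rw [← mul_assoc, ← smul_mul_assoc, ← h', smul_mul_assoc, mul_assoc]
  simp only [this]
  rw [← Finset.smul_sum, ← Finset.mul_sum, hs, Quaternion.mul_coe_eq_smul, smul_smul,
    inv_mul_cancel₀ (pow_ne_zero 2 (norm_ne_zero_iff.2 hv)), one_smul]

theorem continuous_projector : Continuous (projector (m := m)) := by
  rw [isQuotientMap_mk'.continuous_iff]
  refine continuous_pi fun i => continuous_pi fun j => ?_
  change Continuous fun v : {v : Hn m // v ≠ 0} => (‖v.1‖ ^ 2)⁻¹ • (v.1 i * star (v.1 j))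
  have h : ∀ v : {v : Hn m // v ≠ 0}, ‖v.1‖ ^ 2 ≠ 0 :=
    fun v => pow_ne_zero 2 (norm_ne_zero_iff.2 v.2)
  fun_prop (disch := exact h _)

instance : T2Space (QP m) :=
  T2Space.of_injective_continuous projector_injective continuous_projector

/-- The open set `{[a] | a i ≠ 0}`. -/
def affine (i : Fin m) : Set (QP m) :=
  {x | Projectivization.lift (fun v : {v : Hn m // v ≠ 0} => v.1 i ≠ 0) (by
    rintro ⟨a, ha⟩ ⟨b, hb⟩ t h
    have ht := ne_zero_of_eq_smul ha h
    simp only at h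
    simp [h, ht]) x}

/-- The homogeneous coordinates of a line, normalized by `a i = 1`: `[a] ↦ a * (a i)⁻¹`. -/
noncomputable def normalize (i : Fin m) (x : QP m) : Hn m :=
  Projectivization.lift (fun v : {v : Hn m // v ≠ 0} => MulOpposite.op (v.1 i)⁻¹ • v.1) (by
    rintro ⟨a, ha⟩ ⟨b, hb⟩ t h
    have ht := ne_zero_of_eq_smul ha h
    dsimp only at h
    ext1 j
    simp only [h, smul_coord, MulOpposite.unop_op, mul_inv_rev]
    rw [mul_assoc, mul_inv_cancel_left₀ ht]) x

theorem isOpen_affine (i : Fin m) : IsOpen (affine i) := by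
  rw [← isQuotientMap_mk'.isOpen_preimage]
  change IsOpen {v : {v : Hn m // v ≠ 0} | v.1 i ≠ 0}
  exact isOpen_ne_fun (by fun_prop) (by fun_prop)

theorem exists_mem_affine (x : QP m) : ∃ i, x ∈ affine i := by
  obtain ⟨v, hv, rfl⟩ := exists_rep x
  by_contra! h
  apply hv
  ext1 i
  exact not_not.1 (h i)

theorem continuousOn_normalize (i : Fin m) : ContinuousOn (normalize i) (affine i) := by
  rw [isQuotientMap_mk'.continuousOn_isOpen_iff (isOpen_affine i)]
  change ContinuousOn (fun v : {v : Hn m // v ≠ 0} => MulOpposite.op (v.1 i)⁻¹ • v.1)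
    {v | v.1 i ≠ 0}
  refine (PiLp.continuous_toLp 2 _).comp_continuousOn (continuousOn_pi.2 fun j => ?_)
  change ContinuousOn (fun v : {v : Hn m // v ≠ 0} => v.1 j * (v.1 i)⁻¹) {v | v.1 i ≠ 0}
  refine ContinuousOn.mul (by fun_prop) (ContinuousOn.inv₀ (by fun_prop) fun v hv => hv)

theorem normalize_self {i : Fin m} {x : QP m} (hx : x ∈ affine i) : normalize i x i = 1 := by
  obtain ⟨v, hv, rfl⟩ := exists_rep x
  exact mul_inv_cancel₀ hx

theorem normalize_mk {i : Fin m} {v : Hn m} (hv : v ≠ 0) (j : Fin m) :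
    normalize i (Projectivization.mk _ v hv) j = v j * (v i)⁻¹ := rfl

theorem mk_mem_affine {i : Fin m} {v : Hn m} (hv : v ≠ 0) :
    (Projectivization.mk _ v hv : QP m) ∈ affine i ↔ v i ≠ 0 := Iff.rfl

theorem ne_zero_of_apply_eq_one {v : Hn m} {i : Fin m} (h : v i = 1) : v ≠ 0 := by
  rintro rfl
  exact zero_ne_one h

theorem mk_normalize {i : Fin m} {x : QP m} (hx : x ∈ affine i) :
    Projectivization.mk ℍ[ℝ]ᵐᵒᵖ (normalize i x) (ne_zero_of_apply_eq_one (normalize_self hx)) = x := by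
  obtain ⟨v, hv, rfl⟩ := exists_rep x
  exact (Projectivization.mk_eq_mk_iff' _ _ _ _ _).2 ⟨_, rfl⟩

theorem continuous_mk {X : Type*} [TopologicalSpace X] {f : X → Hn m} (hf : Continuous f)
    (h0 : ∀ x, f x ≠ 0) : Continuous fun x => (Projectivization.mk ℍ[ℝ]ᵐᵒᵖ (f x) (h0 x) : QP m) :=
  isQuotientMap_mk'.continuous.comp (hf.subtype_mk h0)

end QP

/-- Quaternionic projective space `ℍℙⁿ`. -/
abbrev HP (n : ℕ) : Type := QP (n + 1)

namespace HP

variable {n : ℕ}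

/-- Insert a coordinate `1` at the place `i`. -/
noncomputable def insertOne (i : Fin (n + 1)) (b : Hn n) : Hn (n + 1) :=
  WithLp.toLp 2 (i.insertNth (1 : ℍ[ℝ]) b.ofLp : Fin (n + 1) → ℍ[ℝ])

theorem insertOne_self (i : Fin (n + 1)) (b : Hn n) : insertOne i b i = 1 :=
  Fin.insertNth_apply_same (α := fun _ => ℍ[ℝ]) _ _ _

theorem insertOne_succAbove (i : Fin (n + 1)) (b : Hn n) (j : Fin n) :
    insertOne i b (i.succAbove j) = b j :=
  Fin.insertNth_apply_succAbove (α := fun _ => ℍ[ℝ]) _ _ _ _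

theorem contDiff_insertOne (i : Fin (n + 1)) : ContDiff ℝ ∞ (insertOne (n := n) i) := by
  rw [contDiff_piLp]
  intro j
  rcases Fin.eq_self_or_eq_succAbove i j with rfl | ⟨k, rfl⟩
  · simp only [insertOne_self]; exact contDiff_const
  · simp only [insertOne_succAbove]; exact contDiff_piLp_apply 2

/-- The standard chart `[a] ↦ (a j * (a i)⁻¹)_{j ≠ i}` of `ℍℙⁿ`, defined where `a i ≠ 0`. -/
noncomputable def chart (i : Fin (n + 1)) : OpenPartialHomeomorph (HP n) (Hn n) where
  toFun x := WithLp.toLp 2 fun j => QP.normalize i x (i.succAbove j)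
  invFun b := Projectivization.mk _ (insertOne i b) (QP.ne_zero_of_apply_eq_one (insertOne_self i b))
  source := QP.affine i
  target := univ
  map_source' _ _ := mem_univ _
  map_target' b _ := by
    rw [QP.mk_mem_affine, insertOne_self]; exact one_ne_zero
  left_inv' x hx := by
    conv_rhs => rw [← QP.mk_normalize hx]
    congr 1
    ext1 j
    rcases Fin.eq_self_or_eq_succAbove i j with rfl | ⟨k, rfl⟩
    · rw [insertOne_self, QP.normalize_self hx]
    · rw [insertOne_succAbove]
  right_inv' b _ := by
    ext1 j
    simp only [QP.normalize_mk]
    rw [insertOne_succAbove, insertOne_self, inv_one, mul_one]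
  open_source := QP.isOpen_affine i
  open_target := isOpen_univ
  continuousOn_toFun := by
    have := QP.continuousOn_normalize (m := n + 1) i
    fun_prop
  continuousOn_invFun :=
    (QP.continuous_mk (contDiff_insertOne i).continuous _).continuousOn

noncomputable instance : ChartedSpace (Hn n) (HP n) where
  atlas := range chart
  chartAt x := chart (QP.exists_mem_affine x).choose
  mem_chart_source x := (QP.exists_mem_affine x).choose_spec
  chart_mem_atlas _ := mem_range_self _

instance : IsManifold 𝓘(ℝ, Hn n) ∞ (HP n) := by
  refine isManifold_of_contDiffOn _ _ _ ?_
  rintro _ _ ⟨i, rfl⟩ ⟨j, rfl⟩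
  suffices h : ContDiffOn ℝ ∞ (chart j ∘ (chart (n := n) i).symm)
      ((chart i).symm.trans (chart j)).source by simpa using h
  intro b hb
  have hb : insertOne i b j ≠ 0 := hb.2
  refine ContDiffAt.contDiffWithinAt ?_
  rw [contDiffAt_piLp]
  intro k
  have hc : ∀ l, ContDiff ℝ ∞ fun b : Hn n => insertOne i b l :=
    fun l => (contDiff_piLp_apply 2).comp (contDiff_insertOne i)
  have hi : ContDiffAt ℝ ∞ (fun b : Hn n => (insertOne i b j)⁻¹) b :=
    (contDiffAt_quaternion_inv hb).comp b (hc j).contDiffAt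
  exact (hc _).contDiffAt.mul hi

end HP

/-! ## Gluing two smooth manifolds along an open overlap -/

/-- Data for gluing the manifolds `A` and `B` (modelled on `E`) along a manifold `W`:
smooth open embeddings of `W` into `A` and into `B`. -/
structure SmoothGluing (E : Type*) [NormedAddCommGroup E] [NormedSpace ℝ E] (W A B : Type*)
    [TopologicalSpace W] [ChartedSpace E W] [TopologicalSpace A] [ChartedSpace E A]
    [TopologicalSpace B] [ChartedSpace E B] where
  left : W → A
  right : W → B
  isOpenEmbedding_left : IsOpenEmbedding left
  isOpenEmbedding_right : IsOpenEmbedding right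
  isLocalDiffeomorph_left : IsLocalDiffeomorph 𝓘(ℝ, E) 𝓘(ℝ, E) ∞ left
  isLocalDiffeomorph_right : IsLocalDiffeomorph 𝓘(ℝ, E) 𝓘(ℝ, E) ∞ right

namespace SmoothGluing

variable {E : Type*} [NormedAddCommGroup E] [NormedSpace ℝ E] {W A B : Type*}
  [TopologicalSpace W] [ChartedSpace E W] [TopologicalSpace A] [ChartedSpace E A]
  [TopologicalSpace B] [ChartedSpace E B]

/-- The equivalence relation on `A ⊔ B` which identifies `left w` with `right w`. -/
def setoid (D : SmoothGluing E W A B) : Setoid (A ⊕ B) where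
  r x y := x = y ∨ (∃ w, x = .inl (D.left w) ∧ y = .inr (D.right w)) ∨
    ∃ w, x = .inr (D.right w) ∧ y = .inl (D.left w)
  iseqv := by
    refine ⟨fun x => .inl rfl, ?_, ?_⟩
    · rintro x y (rfl | ⟨w, rfl, rfl⟩ | ⟨w, rfl, rfl⟩)
      · exact .inl rfl
      · exact .inr (.inr ⟨w, rfl, rfl⟩)
      · exact .inr (.inl ⟨w, rfl, rfl⟩)
    · rintro x y z (rfl | ⟨w, rfl, rfl⟩ | ⟨w, rfl, rfl⟩) (rfl | ⟨v, h, rfl⟩ | ⟨v, h, rfl⟩)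
      · exact .inl rfl
      · exact .inr (.inl ⟨v, h, rfl⟩)
      · exact .inr (.inr ⟨v, h, rfl⟩)
      · exact .inr (.inl ⟨w, rfl, rfl⟩)
      · cases h
      · obtain rfl := D.isOpenEmbedding_right.injective (Sum.inr.inj h)
        exact .inl rfl
      · exact .inr (.inr ⟨w, rfl, rfl⟩)
      · obtain rfl := D.isOpenEmbedding_left.injective (Sum.inl.inj h)
        exact .inl rfl
      · cases h

/-- The glued space `A ∪_W B`, with the quotient topology. -/
def Glued (D : SmoothGluing E W A B) : Type _ := Quotient D.setoid

instance (D : SmoothGluing E W A B) : TopologicalSpace D.Glued :=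
  inferInstanceAs (TopologicalSpace (Quotient D.setoid))

variable (D : SmoothGluing E W A B)

/-- The canonical map `A → A ∪_W B`. -/
def inl (a : A) : D.Glued := Quotient.mk D.setoid (.inl a)

/-- The canonical map `B → A ∪_W B`. -/
def inr (b : B) : D.Glued := Quotient.mk D.setoid (.inr b)

theorem inl_eq_inr_iff {a : A} {b : B} :
    D.inl a = D.inr b ↔ ∃ w, D.left w = a ∧ D.right w = b := by
  refine Quotient.eq.trans ⟨?_, ?_⟩
  · rintro (h | ⟨w, h, h'⟩ | ⟨w, h, h'⟩)
    · cases h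
    · exact ⟨w, (Sum.inl.inj h).symm, (Sum.inr.inj h').symm⟩
    · cases h
  · rintro ⟨w, rfl, rfl⟩
    exact .inr (.inl ⟨w, rfl, rfl⟩)

theorem inl_injective : Function.Injective D.inl := by
  intro a a' h
  rcases Quotient.eq.1 h with h | ⟨w, h, h'⟩ | ⟨w, h, h'⟩
  · exact Sum.inl.inj h
  · cases h'
  · cases h

theorem inr_injective : Function.Injective D.inr := by
  intro a a' h
  rcases Quotient.eq.1 h with h | ⟨w, h, h'⟩ | ⟨w, h, h'⟩
  · exact Sum.inr.inj h
  · cases h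
  · cases h'

theorem isOpen_iff {s : Set D.Glued} :
    IsOpen s ↔ IsOpen (D.inl ⁻¹' s) ∧ IsOpen (D.inr ⁻¹' s) := by
  have h : IsQuotientMap (Quotient.mk D.setoid) := isQuotientMap_quotient_mk'
  exact (h.isOpen_preimage (s := s)).symm.trans isOpen_sum_iff

theorem isOpenEmbedding_inl : IsOpenEmbedding D.inl := by
  refine .of_continuous_injective_isOpenMap (continuous_quotient_mk'.comp continuous_inl)
    D.inl_injective fun U hU => ?_
  rw [isOpen_iff, preimage_image_eq _ D.inl_injective]
  refine ⟨hU, ?_⟩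
  convert D.isOpenEmbedding_right.isOpenMap _
    (hU.preimage D.isOpenEmbedding_left.continuous) using 1
  ext b
  simp only [mem_preimage, mem_image, inl_eq_inr_iff]
  grind

theorem isOpenEmbedding_inr : IsOpenEmbedding D.inr := by
  refine .of_continuous_injective_isOpenMap (continuous_quotient_mk'.comp continuous_inr)
    D.inr_injective fun U hU => ?_
  rw [isOpen_iff, preimage_image_eq _ D.inr_injective]
  refine ⟨?_, hU⟩
  convert D.isOpenEmbedding_left.isOpenMap _
    (hU.preimage D.isOpenEmbedding_right.continuous) using 1
  ext b
  simp only [mem_preimage, mem_image, eq_comm, inl_eq_inr_iff]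
  grind

/-- The chart of an open piece `f : X → G`, read on `G`. -/
noncomputable def pieceChart {X G : Type*} [TopologicalSpace X] [ChartedSpace E X]
    [TopologicalSpace G] {f : X → G} (hf : IsOpenEmbedding f) (x : X) :
    OpenPartialHomeomorph G E :=
  haveI : Nonempty X := ⟨x⟩
  (hf.toOpenPartialHomeomorph f).symm.trans (chartAt E x)

theorem mem_pieceChart_source {X G : Type*} [TopologicalSpace X] [ChartedSpace E X]
    [TopologicalSpace G] {f : X → G} (hf : IsOpenEmbedding f) (x : X) :
    f x ∈ (pieceChart (E := E) hf x).source := by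
  have : Nonempty X := ⟨x⟩
  have h := (hf.toOpenPartialHomeomorph f).left_inv (x := x) (by simp)
  simp only [IsOpenEmbedding.toOpenPartialHomeomorph_apply] at h
  simp [pieceChart, h]

/-- The charts of `A ∪_W B` are the charts of `A` and those of `B`. -/
noncomputable instance : ChartedSpace E D.Glued where
  atlas := range (pieceChart D.isOpenEmbedding_inl) ∪ range (pieceChart D.isOpenEmbedding_inr)
  chartAt x := Sum.elim (pieceChart D.isOpenEmbedding_inl) (pieceChart D.isOpenEmbedding_inr)
    (Quotient.out x)
  mem_chart_source x := by
    obtain ⟨y, hy⟩ : ∃ y, Quotient.out x = y := ⟨_, rfl⟩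
    have hx : Quotient.mk D.setoid y = x := by rw [← hy]; exact Quotient.out_eq x
    rw [hy, ← hx]
    cases y with
    | inl a => exact mem_pieceChart_source D.isOpenEmbedding_inl a
    | inr b => exact mem_pieceChart_source D.isOpenEmbedding_inr b
  chart_mem_atlas x := by
    cases Quotient.out x with
    | inl a => exact .inl ⟨a, rfl⟩
    | inr b => exact .inr ⟨b, rfl⟩

theorem contDiffOn_pieceChart {X Y G : Type*} [TopologicalSpace X] [ChartedSpace E X]
    [IsManifold 𝓘(ℝ, E) ∞ X] [TopologicalSpace Y] [ChartedSpace E Y] [IsManifold 𝓘(ℝ, E) ∞ Y]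
    [TopologicalSpace G] {f : X → G} {g : Y → G}
    (hf : IsOpenEmbedding f) (hg : IsOpenEmbedding g)
    (h : ∀ x y, f x = g y →
      ∃ k : X → Y, ContMDiffAt 𝓘(ℝ, E) 𝓘(ℝ, E) ∞ k x ∧ ∀ᶠ z in 𝓝 x, f z = g (k z))
    (x : X) (y : Y) :
    ContDiffOn ℝ ∞ (pieceChart (E := E) hg y ∘ (pieceChart (E := E) hf x).symm)
      ((pieceChart (E := E) hf x).symm.trans (pieceChart (E := E) hg y)).source := by
  have : Nonempty X := ⟨x⟩
  have : Nonempty Y := ⟨y⟩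
  intro z hz
  have hginv : ∀ y, (hg.toOpenPartialHomeomorph g).symm (g y) = y := fun y => by
    have h := (hg.toOpenPartialHomeomorph g).left_inv (x := y) (by simp)
    simpa only [IsOpenEmbedding.toOpenPartialHomeomorph_apply] using h
  have hz1 : z ∈ (chartAt E x).target := by
    simp [pieceChart] at hz; exact hz.1
  have hz2 : f ((chartAt E x).symm z) ∈ range g := by
    simp [pieceChart] at hz; simpa using hz.2.1
  have hz3 : (hg.toOpenPartialHomeomorph g).symm (f ((chartAt E x).symm z)) ∈
      (chartAt E y).source := by
    simp [pieceChart] at hz; exact hz.2.2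
  obtain ⟨y', hy'⟩ := hz2
  rw [← hy', hginv] at hz3
  obtain ⟨k, hk, hk'⟩ := h _ _ hy'.symm
  have hky : k ((chartAt E x).symm z) = y' := by
    have := hk'.self_of_nhds
    rw [← hy'] at this
    exact (hg.injective this).symm
  have hc : ContMDiffAt 𝓘(ℝ, E) 𝓘(ℝ, E) ∞ (chartAt E x).symm z :=
    (contMDiffOn_chart_symm (I := 𝓘(ℝ, E)) (n := ∞) (x := x)).contMDiffAt
      ((chartAt E x).open_target.mem_nhds hz1)
  have hc' : ContMDiffAt 𝓘(ℝ, E) 𝓘(ℝ, E) ∞ (chartAt E y) y' :=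
    (contMDiffOn_chart (I := 𝓘(ℝ, E)) (n := ∞) (x := y)).contMDiffAt
      ((chartAt E y).open_source.mem_nhds hz3)
  have hs : ContMDiffAt 𝓘(ℝ, E) 𝓘(ℝ, E) ∞ (chartAt E y ∘ k ∘ (chartAt E x).symm) z := by
    refine ContMDiffAt.comp z (I' := 𝓘(ℝ, E)) ?_ (ContMDiffAt.comp z (I' := 𝓘(ℝ, E)) hk hc)
    simpa [hky] using hc'
  have hs' := contMDiffAt_iff_contDiffAt.1 hs
  refine (hs'.congr_of_eventuallyEq ?_).contDiffWithinAt
  filter_upwards [hc.continuousAt.eventually hk'] with u hu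
  simp [pieceChart, hu, hginv]

/-- The inverse of an injective local diffeomorphism, followed by a smooth map. -/
theorem exists_transition {X Y Z G : Type*} [TopologicalSpace X] [ChartedSpace E X]
    [TopologicalSpace Y] [ChartedSpace E Y] [TopologicalSpace Z] [ChartedSpace E Z]
    {f : X → G} {g : Y → G} {i : Z → X} {j : Z → Y}
    (hi : IsLocalDiffeomorph 𝓘(ℝ, E) 𝓘(ℝ, E) ∞ i) (hj : IsLocalDiffeomorph 𝓘(ℝ, E) 𝓘(ℝ, E) ∞ j)
    (hij : ∀ z, f (i z) = g (j z)) (z : Z) :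
    ∃ k : X → Y, ContMDiffAt 𝓘(ℝ, E) 𝓘(ℝ, E) ∞ k (i z) ∧ ∀ᶠ x in 𝓝 (i z), f x = g (k x) := by
  refine ⟨j ∘ (hi z).localInverse, ?_, ?_⟩
  · exact ContMDiffAt.comp (i z) (hj.contMDiff _) (hi z).localInverse_contMDiffAt
  · filter_upwards [(hi z).localInverse_eventuallyEq_right] with x hx
    rw [Function.comp_apply, ← hij]
    exact congrArg f hx.symm

instance [IsManifold 𝓘(ℝ, E) ∞ A] [IsManifold 𝓘(ℝ, E) ∞ B] :
    IsManifold 𝓘(ℝ, E) ∞ D.Glued := by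
  refine isManifold_of_contDiffOn _ _ _ fun e e' he he' => ?_
  suffices h : ContDiffOn ℝ ∞ (e' ∘ e.symm) (e.symm.trans e').source by
    simpa using h
  have hlr : ∀ w, D.inl (D.left w) = D.inr (D.right w) :=
    fun w => D.inl_eq_inr_iff.2 ⟨w, rfl, rfl⟩
  rcases he with ⟨x, rfl⟩ | ⟨x, rfl⟩ <;> rcases he' with ⟨y, rfl⟩ | ⟨y, rfl⟩ <;>
    refine contDiffOn_pieceChart _ _ (fun a b hab => ?_) x y
  · exact ⟨id, contMDiffAt_id, by simp⟩
  · obtain ⟨w, rfl, rfl⟩ := D.inl_eq_inr_iff.1 hab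
    exact exists_transition D.isLocalDiffeomorph_left D.isLocalDiffeomorph_right hlr w
  · obtain ⟨w, rfl, rfl⟩ := D.inl_eq_inr_iff.1 hab.symm
    exact exists_transition D.isLocalDiffeomorph_right D.isLocalDiffeomorph_left
      (fun w => (hlr w).symm) w
  · exact ⟨id, contMDiffAt_id, by simp⟩

end SmoothGluing

/-- A diffeomorphism between open subsets of two manifolds, restricted to open submanifolds, is an
open embedding and a local diffeomorphism. -/
theorem isOpenEmbedding_isLocalDiffeomorph_of_restrict {E : Type*} [NormedAddCommGroup E]
    [NormedSpace ℝ E] {X Y : Type*} [TopologicalSpace X] [ChartedSpace E X]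
    [TopologicalSpace Y] [ChartedSpace E Y] {U : Opens X} {V : Opens Y} (i : U → V)
    (hΦ : U → ∃ Φ : OpenPartialHomeomorph X Y, (U : Set X) ⊆ Φ.source ∧
      ContMDiffOn 𝓘(ℝ, E) 𝓘(ℝ, E) ∞ Φ Φ.source ∧
      ContMDiffOn 𝓘(ℝ, E) 𝓘(ℝ, E) ∞ Φ.symm Φ.target ∧ ∀ u : U, (i u : Y) = Φ u) :
    IsOpenEmbedding i ∧ IsLocalDiffeomorph 𝓘(ℝ, E) 𝓘(ℝ, E) ∞ i := by
  rcases isEmpty_or_nonempty U with hU | ⟨⟨u₀⟩⟩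
  · exact ⟨⟨⟨⟨Subsingleton.elim _ _⟩, Function.injective_of_subsingleton _⟩, by
      simp [range_eq_empty]⟩, fun x => hU.elim x⟩
  obtain ⟨Φ, hUs, hs, hs', hi⟩ := hΦ u₀
  have hiv : Subtype.val ∘ i = fun u : U => Φ u := funext hi
  have hsm : ContMDiff 𝓘(ℝ, E) 𝓘(ℝ, E) ∞ i := by
    rw [← ContMDiff.subtypeVal_comp_iff, hiv]
    intro u
    exact contMDiffAt_subtype_iff.2 (hs.contMDiffAt (Φ.open_source.mem_nhds (hUs u.2)))
  have hinj : Function.Injective i := by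
    intro u v h
    have : Φ u = Φ v := by rw [← hi, ← hi, h]
    exact Subtype.ext (Φ.injOn (hUs u.2) (hUs v.2) this)
  have hopen : IsOpenMap i := by
    intro O hO
    refine V.2.isOpenEmbedding_subtypeVal.isOpen_iff_image_isOpen.2 ?_
    have h1 : IsOpen (Φ '' (Subtype.val '' O)) :=
      Φ.isOpen_image_of_subset_source (U.2.isOpenEmbedding_subtypeVal.isOpenMap _ hO)
        ((Subtype.coe_image_subset _ _).trans hUs)
    convert h1 using 1
    rw [image_image, image_image]
    exact image_congr fun u _ => hi u
  have hemb : IsOpenEmbedding i := .of_continuous_injective_isOpenMap hsm.continuous hinj hopen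
  refine ⟨hemb, fun u => ?_⟩
  have : Nonempty U := ⟨u₀⟩
  let Ψ := hemb.toOpenPartialHomeomorph i
  have hleft : ∀ u, Ψ.symm (i u) = u := fun u => by
    have h := Ψ.left_inv (x := u) (by simp [Ψ])
    simpa only [Ψ, IsOpenEmbedding.toOpenPartialHomeomorph_apply] using h
  refine ⟨⟨Ψ.toPartialEquiv, Ψ.open_source, Ψ.open_target, hsm.contMDiffOn, ?_⟩, mem_univ _,
    fun _ _ => rfl⟩
  intro v hv
  obtain ⟨u, rfl⟩ : v ∈ range i := by simpa [Ψ] using hv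
  refine ContMDiffAt.contMDiffWithinAt ?_
  rw [← ContMDiffAt.subtypeVal_comp_iff]
  have h2 : ContMDiffAt 𝓘(ℝ, E) 𝓘(ℝ, E) ∞ (fun v : V => Φ.symm v) (i u) := by
    refine contMDiffAt_subtype_iff.2 (hs'.contMDiffAt (Φ.open_target.mem_nhds ?_))
    rw [hi]
    exact Φ.map_source (hUs u.2)
  refine h2.congr_of_eventuallyEq ?_
  filter_upwards [hemb.isOpen_range.mem_nhds (mem_range_self u)] with v hv
  obtain ⟨u', rfl⟩ := hv
  change ((Ψ.symm (i u') : U) : X) = _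
  rw [hleft, hi, Φ.left_inv (hUs u'.2)]

/-! ## The blow-up of quaternionic space at the origin -/

/-- The blow-up of `ℍⁿ` at `0`: pairs of a point `q` and a line containing it, with the subspace
topology of `ℍⁿ × ℍℙⁿ⁻¹`. -/
def Bl (n : ℕ) : Type := {x : Hn n × QP n // x.1 ∈ x.2.submodule}

namespace Bl

variable {n : ℕ}

instance : TopologicalSpace (Bl n) :=
  inferInstanceAs (TopologicalSpace {x : Hn n × QP n // x.1 ∈ x.2.submodule})

/-- The projection to `ℍⁿ`. -/
def π₁ (x : Bl n) : Hn n := x.1.1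

/-- The projection to `ℍℙⁿ⁻¹`. -/
def π₂ (x : Bl n) : QP n := x.1.2

theorem continuous_π₁ : Continuous (π₁ (n := n)) := continuous_fst.comp continuous_subtype_val

theorem continuous_π₂ : Continuous (π₂ (n := n)) := continuous_snd.comp continuous_subtype_val

/-- The vector `(b₁, …, 1, …, bₙ)`, with `1` at the place `i`. -/
noncomputable def replaceOne (i : Fin n) (b : Hn n) : Hn n :=
  WithLp.toLp 2 (Function.update b.ofLp i 1)

theorem replaceOne_self (i : Fin n) (b : Hn n) : replaceOne i b i = 1 :=
  Function.update_self _ _ _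

theorem replaceOne_of_ne {i j : Fin n} (h : j ≠ i) (b : Hn n) : replaceOne i b j = b j :=
  Function.update_of_ne h _ _

theorem contDiff_replaceOne (i : Fin n) : ContDiff ℝ ∞ (replaceOne (n := n) i) := by
  rw [contDiff_piLp]
  intro j
  by_cases h : j = i
  · subst h; simp only [replaceOne_self]; exact contDiff_const
  · simp only [replaceOne_of_ne h]; exact contDiff_piLp_apply 2

/-- The point `q = (b₁ bᵢ, …, bᵢ, …, bₙ bᵢ)`. -/
noncomputable def point (i : Fin n) (b : Hn n) : Hn n := MulOpposite.op (b i) • replaceOne i b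

theorem point_apply (i j : Fin n) (b : Hn n) : point i b j = replaceOne i b j * b i := rfl

theorem contDiff_point (i : Fin n) : ContDiff ℝ ∞ (point (n := n) i) := by
  rw [contDiff_piLp]
  intro j
  exact ((contDiff_piLp_apply 2).comp (contDiff_replaceOne i)).mul (contDiff_piLp_apply 2)

/-- The point with coordinates `b` in the `i`-th chart. -/
noncomputable def ofCoord (i : Fin n) (b : Hn n) : Bl n :=
  ⟨(point i b, Projectivization.mk _ (replaceOne i b)
    (QP.ne_zero_of_apply_eq_one (replaceOne_self i b))),
    Submodule.smul_mem _ _ (Submodule.mem_span_singleton_self _)⟩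

/-- The standard chart of the blow-up, on the open set `a i ≠ 0`:
`(q, [a]) ↦ (a₁ aᵢ⁻¹, …, qᵢ, …, aₙ aᵢ⁻¹)`, with `qᵢ` at the place `i`. -/
noncomputable def chart (i : Fin n) : OpenPartialHomeomorph (Bl n) (Hn n) where
  toFun x := WithLp.toLp 2 (Function.update (QP.normalize i x.π₂).ofLp i (x.π₁ i))
  invFun := ofCoord i
  source := π₂ ⁻¹' QP.affine i
  target := univ
  map_source' _ _ := mem_univ _
  map_target' b _ := by
    change replaceOne i b i ≠ 0
    rw [replaceOne_self]; exact one_ne_zero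
  left_inv' := by
    rintro ⟨⟨q, l⟩, hq⟩ hx
    change l ∈ QP.affine i at hx
    have h1 : replaceOne i (WithLp.toLp 2 (Function.update (QP.normalize i l).ofLp i (q i))) =
        QP.normalize i l := by
      ext1 j
      by_cases h : j = i
      · subst h; rw [replaceOne_self, QP.normalize_self hx]
      · rw [replaceOne_of_ne h]; exact Function.update_of_ne h _ _
    have h2 : point i (WithLp.toLp 2 (Function.update (QP.normalize i l).ofLp i (q i))) = q := by
      rw [point, h1]
      change MulOpposite.op (Function.update (QP.normalize i l).ofLp i (q i) i) • _ = _
      rw [Function.update_self]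
      dsimp only at hq
      rw [← QP.mk_normalize hx, Projectivization.submodule_mk, Submodule.mem_span_singleton] at hq
      obtain ⟨t, rfl⟩ := hq
      rw [QP.smul_coord, QP.normalize_self hx, one_mul, MulOpposite.op_unop]
    refine Subtype.ext (Prod.ext h2 ?_)
    refine Eq.trans ?_ (QP.mk_normalize hx)
    simp only [ofCoord, π₁, π₂, h1]
  right_inv' b _ := by
    ext1 j
    by_cases h : j = i
    · subst h
      refine (Function.update_self _ _ _).trans ?_
      change point j b j = _
      rw [point_apply, replaceOne_self, one_mul]
    · refine (Function.update_of_ne h _ _).trans ?_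
      change replaceOne i b j * (replaceOne i b i)⁻¹ = _
      rw [replaceOne_self, inv_one, mul_one, replaceOne_of_ne h]
  open_source := (QP.isOpen_affine i).preimage continuous_π₂
  open_target := isOpen_univ
  continuousOn_toFun := by
    have h : ContinuousOn (fun x : Bl n => QP.normalize i x.π₂) (π₂ ⁻¹' QP.affine i) :=
      (QP.continuousOn_normalize i).comp continuous_π₂.continuousOn fun _ h => h
    refine (PiLp.continuous_toLp 2 _).comp_continuousOn (continuousOn_pi.2 fun j => ?_)
    by_cases hj : j = i
    · subst hj
      simp only [Function.update_self]
      exact ((PiLp.continuous_apply 2 _ j).comp continuous_π₁).continuousOn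
    · simp only [Function.update_of_ne hj]
      exact (PiLp.continuous_apply 2 _ j).comp_continuousOn h
  continuousOn_invFun := by
    refine Continuous.continuousOn (Continuous.subtype_mk ?_ _)
    exact (contDiff_point i).continuous.prodMk
      (QP.continuous_mk (contDiff_replaceOne i).continuous _)

theorem chart_ofCoord_apply_self (i j : Fin n) (b : Hn n) :
    chart j (ofCoord i b) j = point i b j := Function.update_self _ _ _

theorem chart_ofCoord_apply_of_ne {i j k : Fin n} (h : k ≠ j) (b : Hn n) :
    chart j (ofCoord i b) k = replaceOne i b k * (replaceOne i b j)⁻¹ :=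
  Function.update_of_ne h _ _

noncomputable instance : ChartedSpace (Hn n) (Bl n) where
  atlas := range chart
  chartAt x := chart (QP.exists_mem_affine x.π₂).choose
  mem_chart_source x := (QP.exists_mem_affine x.π₂).choose_spec
  chart_mem_atlas _ := mem_range_self _

instance : IsManifold 𝓘(ℝ, Hn n) ∞ (Bl n) := by
  refine isManifold_of_contDiffOn _ _ _ ?_
  rintro _ _ ⟨i, rfl⟩ ⟨j, rfl⟩
  suffices h : ContDiffOn ℝ ∞ (chart j ∘ (chart (n := n) i).symm)
      ((chart i).symm.trans (chart j)).source by simpa using h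
  intro b hb
  have hb : replaceOne i b j ≠ 0 := hb.2
  refine ContDiffAt.contDiffWithinAt ?_
  rw [contDiffAt_piLp]
  intro k
  change ContDiffAt ℝ ∞ (fun b => chart j (ofCoord i b) k) b
  have hc : ∀ l, ContDiff ℝ ∞ fun b : Hn n => replaceOne i b l :=
    fun l => (contDiff_piLp_apply 2).comp (contDiff_replaceOne i)
  have hi : ContDiffAt ℝ ∞ (fun b : Hn n => (replaceOne i b j)⁻¹) b :=
    (contDiffAt_quaternion_inv hb).comp b (hc j).contDiffAt
  by_cases hk : k = j
  · subst hk
    simp only [chart_ofCoord_apply_self]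
    exact ((contDiff_piLp_apply 2).comp (contDiff_point i)).contDiffAt
  · simp only [chart_ofCoord_apply_of_ne hk]
    exact (hc k).contDiffAt.mul hi

theorem contMDiff_π₁ : ContMDiff 𝓘(ℝ, Hn n) 𝓘(ℝ, Hn n) ∞ (π₁ (n := n)) := by
  intro x
  obtain ⟨i, hi⟩ := QP.exists_mem_affine x.π₂
  have hc : ContMDiffAt 𝓘(ℝ, Hn n) 𝓘(ℝ, Hn n) ∞ (chart i) x :=
    (contMDiffOn_of_mem_maximalAtlas
      (IsManifold.subset_maximalAtlas (mem_range_self i))).contMDiffAt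
      ((chart i).open_source.mem_nhds hi)
  refine ((contDiff_point i).contMDiff.contMDiffAt.comp x hc).congr_of_eventuallyEq ?_
  filter_upwards [(chart i).open_source.mem_nhds hi] with y hy
  exact congrArg π₁ ((chart i).left_inv hy).symm

theorem π₁_mem (x : Bl n) : x.π₁ ∈ x.π₂.submodule := x.2

/-- The point `(q, [q])` over `q ≠ 0` (and the junk value `x₀` at `q = 0`). -/
noncomputable def lineOver (x₀ : Bl n) (q : Hn n) : Bl n :=
  open Classical in
  if h : q = 0 then x₀ else ⟨(q, Projectivization.mk _ q h), Submodule.mem_span_singleton_self _⟩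

theorem lineOver_of_ne (x₀ : Bl n) {q : Hn n} (h : q ≠ 0) :
    lineOver x₀ q = ⟨(q, Projectivization.mk _ q h), Submodule.mem_span_singleton_self _⟩ :=
  dif_neg h

/-- Away from the exceptional set `π₁ = 0`, the projection `π₁` is a diffeomorphism onto
`ℍⁿ ∖ {0}`, with inverse `q ↦ (q, [q])`. -/
noncomputable def puncturedEquiv (x₀ : Bl n) : OpenPartialHomeomorph (Bl n) (Hn n) where
  toFun := π₁
  invFun := lineOver x₀
  source := {x | x.π₁ ≠ 0}
  target := {q | q ≠ 0}
  map_source' _ h := h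
  map_target' q h := by
    change q ≠ 0 at h
    rw [lineOver_of_ne x₀ h]
    exact h
  left_inv' := by
    rintro ⟨⟨q, l⟩, hq⟩ hx
    change q ≠ 0 at hx
    refine (lineOver_of_ne x₀ hx).trans ?_
    refine Subtype.ext (Prod.ext rfl ?_)
    obtain ⟨v, hv, rfl⟩ := QP.exists_rep l
    exact (Projectivization.mk_eq_mk_iff' _ _ _ _ _).2 (Submodule.mem_span_singleton.1 hq)
  right_inv' q h := by
    change q ≠ 0 at h
    rw [lineOver_of_ne x₀ h]
    rfl
  open_source := isOpen_ne_fun continuous_π₁ continuous_const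
  open_target := isOpen_ne
  continuousOn_toFun := continuous_π₁.continuousOn
  continuousOn_invFun := by
    rw [continuousOn_iff_continuous_domRestrict]
    have : Continuous fun q : {q : Hn n | q ≠ 0} =>
        (⟨(q.1, Projectivization.mk _ q.1 q.2), Submodule.mem_span_singleton_self _⟩ : Bl n) :=
      Continuous.subtype_mk
        (continuous_subtype_val.prodMk (QP.continuous_mk continuous_subtype_val _)) _
    convert this using 1
    exact iff_of_eq (congrArg _ (funext fun q => lineOver_of_ne x₀ q.2))

theorem contMDiffOn_puncturedEquiv_symm (x₀ : Bl n) : ContMDiffOn 𝓘(ℝ, Hn n) 𝓘(ℝ, Hn n) ∞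
    (puncturedEquiv x₀).symm (puncturedEquiv x₀).target := by
  intro q hq
  change q ≠ 0 at hq
  obtain ⟨i, hi⟩ : ∃ i, q i ≠ 0 := by
    by_contra! h
    exact hq (by ext1 i; exact h i)
  have hs : ContMDiff 𝓘(ℝ, Hn n) 𝓘(ℝ, Hn n) ∞ (ofCoord (n := n) i) := by
    rw [← contMDiffOn_univ]
    exact contMDiffOn_symm_of_mem_maximalAtlas (e := chart i)
      (IsManifold.subset_maximalAtlas (mem_range_self i))
  have hF : ContDiffAt ℝ ∞ (fun q : Hn n => (WithLp.toLp 2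
      (Function.update (fun j => q j * (q i)⁻¹) i (q i)) : Hn n)) q := by
    rw [contDiffAt_piLp]
    intro k
    have hi' : ContDiffAt ℝ ∞ (fun b : Hn n => (b i)⁻¹) q :=
      (contDiffAt_quaternion_inv hi).comp q (contDiff_piLp_apply 2).contDiffAt
    by_cases hk : k = i
    · subst hk
      simp only [Function.update_self]
      exact (contDiff_piLp_apply 2).contDiffAt
    · simp only [Function.update_of_ne hk]
      exact (contDiff_piLp_apply 2).contDiffAt.mul hi'
  refine ContMDiffAt.contMDiffWithinAt ?_
  refine (hs.contMDiffAt.comp q hF.contMDiffAt).congr_of_eventuallyEq ?_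
  have hcont : Continuous fun q : Hn n => q i := PiLp.continuous_apply 2 _ i
  filter_upwards [(isOpen_ne_fun hcont continuous_const).mem_nhds hi] with r hr
  have hr0 : r ≠ 0 := by
    rintro rfl
    exact hr rfl
  have h1 : (puncturedEquiv x₀).symm r =
      (⟨(r, Projectivization.mk _ r hr0), Submodule.mem_span_singleton_self _⟩ : Bl n) :=
    lineOver_of_ne x₀ hr0
  rw [h1]
  exact ((chart i).left_inv (x := (⟨(r, Projectivization.mk _ r hr0),
    Submodule.mem_span_singleton_self _⟩ : Bl n)) hr).symm

end Bl

/-! ## Coordinate balls, connected sums, blow-ups -/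

/-- A smooth chart of the manifold `M`, with values in `E`, that sends the point `p` to `0`. -/
structure CenteredChart (E : Type*) [NormedAddCommGroup E] [NormedSpace ℝ E] (M : Type*)
    [TopologicalSpace M] [ChartedSpace E M] (p : M) where
  chart : OpenPartialHomeomorph M E
  mem_maximalAtlas : chart ∈ IsManifold.maximalAtlas 𝓘(ℝ, E) ∞ M
  mem_source : p ∈ chart.source
  map_center : chart p = 0

/-- A centered chart whose image contains the closed unit ball. -/
structure CoordBall (E : Type*) [NormedAddCommGroup E] [NormedSpace ℝ E] (M : Type*)
    [TopologicalSpace M] [ChartedSpace E M] (p : M) extends CenteredChart E M p where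
  closedBall_subset : Metric.closedBall 0 1 ⊆ chart.target

namespace CenteredChart

variable {E : Type*} [NormedAddCommGroup E] [NormedSpace ℝ E] {M : Type*}
  [TopologicalSpace M] [ChartedSpace E M] {p : M} (φ : CenteredChart E M p)

theorem zero_mem_target : 0 ∈ φ.chart.target := by
  rw [← φ.map_center]; exact φ.chart.map_source φ.mem_source

theorem symm_zero : φ.chart.symm 0 = p := by
  rw [← φ.map_center]; exact φ.chart.left_inv φ.mem_source

theorem contMDiffOn [IsManifold 𝓘(ℝ, E) ∞ M] :
    ContMDiffOn 𝓘(ℝ, E) 𝓘(ℝ, E) ∞ φ.chart φ.chart.source :=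
  contMDiffOn_of_mem_maximalAtlas φ.mem_maximalAtlas

theorem contMDiffOn_symm [IsManifold 𝓘(ℝ, E) ∞ M] :
    ContMDiffOn 𝓘(ℝ, E) 𝓘(ℝ, E) ∞ φ.chart.symm φ.chart.target :=
  contMDiffOn_symm_of_mem_maximalAtlas φ.mem_maximalAtlas

end CenteredChart

namespace ConnectedSum

section Inversion

variable {E : Type*} [NormedAddCommGroup E] [InnerProductSpace ℝ E]

/-- The inversion `x ↦ x / |x|²` in the unit sphere. -/
noncomputable def inv (x : E) : E := (‖x‖ ^ 2)⁻¹ • x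

theorem inv_ne_zero {x : E} (h : x ≠ 0) : inv x ≠ 0 :=
  smul_ne_zero (_root_.inv_ne_zero (pow_ne_zero 2 (norm_ne_zero_iff.2 h))) h

theorem inv_inv (x : E) : inv (inv x) = x := by
  rcases eq_or_ne x 0 with rfl | h
  · simp [inv]
  have h' : ‖x‖ ≠ 0 := norm_ne_zero_iff.2 h
  simp only [inv, norm_smul, norm_inv, norm_pow, norm_norm, smul_smul]
  rw [show ((‖x‖ ^ 2)⁻¹ * ‖x‖) ^ 2 = (‖x‖ ^ 2)⁻¹ by field_simp, _root_.inv_inv,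
    mul_inv_cancel₀ (pow_ne_zero 2 h'), one_smul]

theorem contDiffOn_inv : ContDiffOn ℝ ∞ (inv (E := E)) {x | x ≠ 0} := by
  intro x hx
  refine ContDiffAt.contDiffWithinAt ?_
  exact ((contDiff_norm_sq ℝ).contDiffAt.inv (pow_ne_zero 2 (norm_ne_zero_iff.2 hx))).smul
    contDiffAt_id

/-- The inversion as a homeomorphism of `E ∖ {0}`. -/
noncomputable def invHomeo : OpenPartialHomeomorph E E where
  toFun := inv
  invFun := inv
  source := {x | x ≠ 0}
  target := {x | x ≠ 0}
  map_source' _ h := inv_ne_zero h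
  map_target' _ h := inv_ne_zero h
  left_inv' x _ := inv_inv x
  right_inv' x _ := inv_inv x
  open_source := isOpen_ne
  open_target := isOpen_ne
  continuousOn_toFun := contDiffOn_inv.continuousOn
  continuousOn_invFun := contDiffOn_inv.continuousOn

end Inversion

variable {E : Type*} [NormedAddCommGroup E] [InnerProductSpace ℝ E] [FiniteDimensional ℝ E]
  {M N : Type*} [TopologicalSpace M] [ChartedSpace E M] [TopologicalSpace N] [ChartedSpace E N]
  {p : M} {q : N}

/-- The vectors `x ≠ 0` such that both `φ⁻¹(x)` and `ψ⁻¹(x / |x|²)` are defined: an open set which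
contains the unit sphere. -/
def overlap (φ : CoordBall E M p) (ψ : CoordBall E N q) : Opens E where
  carrier := {x | x ∈ φ.chart.target ∧ x ≠ 0 ∧ inv x ∈ ψ.chart.target}
  is_open' := φ.chart.open_target.inter
    (invHomeo.isOpen_inter_preimage ψ.chart.open_target)

/-- The open submanifold of `M` obtained by removing from the ball `φ⁻¹(|x| ≤ 1)` what does not
belong to the overlap. It contains `M ∖ φ⁻¹(|x| < 1)`, and it does not contain the center. -/
def side [T2Space M] (φ : CoordBall E M p) (ψ : CoordBall E N q) : Opens M where
  carrier := (φ.chart.symm '' (Metric.closedBall 0 1 \ overlap φ ψ))ᶜ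
  is_open' := by
    rw [isOpen_compl_iff]
    refine IsCompact.isClosed ?_
    refine ((isCompact_closedBall 0 1).diff (overlap φ ψ).2).image_of_continuousOn ?_
    exact φ.chart.continuousOn_symm.mono (sdiff_subset.trans φ.closedBall_subset)

theorem symm_mem_side [T2Space M] (φ : CoordBall E M p) (ψ : CoordBall E N q) {x : E}
    (hx : x ∈ overlap φ ψ) : φ.chart.symm x ∈ side φ ψ := by
  rintro ⟨y, ⟨hy, hy'⟩, h⟩
  exact hy' (φ.chart.symm.injOn hx.1 (φ.closedBall_subset hy) h.symm ▸ hx)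

theorem inv_mem_overlap {φ : CoordBall E M p} {ψ : CoordBall E N q} {x : E}
    (hx : x ∈ overlap φ ψ) : inv x ∈ overlap ψ φ :=
  ⟨hx.2.2, inv_ne_zero hx.2.1, by rw [inv_inv]; exact hx.1⟩

end ConnectedSum

section

variable {E : Type*} [NormedAddCommGroup E] [InnerProductSpace ℝ E] [FiniteDimensional ℝ E]
  {M N : Type*} [TopologicalSpace M] [T2Space M] [ChartedSpace E M] [IsManifold 𝓘(ℝ, E) ∞ M]
  [TopologicalSpace N] [T2Space N] [ChartedSpace E N] [IsManifold 𝓘(ℝ, E) ∞ N]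
  {p : M} {q : N}

open ConnectedSum in
/-- The gluing of the connected sum: `φ⁻¹(x)` is identified with `ψ⁻¹(x / |x|²)`. -/
noncomputable def connectedSumGluing (φ : CoordBall E M p) (ψ : CoordBall E N q) :
    SmoothGluing E (overlap φ ψ) (side φ ψ) (side ψ φ) :=
  let l : overlap φ ψ → side φ ψ := fun x => ⟨φ.chart.symm x, symm_mem_side φ ψ x.2⟩
  let r : overlap φ ψ → side ψ φ :=
    fun x => ⟨ψ.chart.symm (inv x), symm_mem_side ψ φ (inv_mem_overlap x.2)⟩
  have hl : IsOpenEmbedding l ∧ IsLocalDiffeomorph 𝓘(ℝ, E) 𝓘(ℝ, E) ∞ l := by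
    refine isOpenEmbedding_isLocalDiffeomorph_of_restrict _ fun _ => ⟨φ.chart.symm,
      fun x hx => hx.1, φ.contMDiffOn_symm, ?_, fun _ => rfl⟩
    simpa using φ.contMDiffOn
  have hr : IsOpenEmbedding r ∧ IsLocalDiffeomorph 𝓘(ℝ, E) 𝓘(ℝ, E) ∞ r := by
    refine isOpenEmbedding_isLocalDiffeomorph_of_restrict _ fun _ => ⟨invHomeo.trans ψ.chart.symm,
      fun x hx => hx.2, ?_, ?_, fun _ => rfl⟩
    · exact ψ.contMDiffOn_symm.comp (contDiffOn_inv.contMDiffOn.mono inter_subset_left)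
        inter_subset_right
    · refine contDiffOn_inv.contMDiffOn.comp (ψ.contMDiffOn.mono ?_) ?_
      · intro x hx
        simpa using hx.1
      · intro x hx
        exact hx.2
  { left := l
    right := r
    isOpenEmbedding_left := hl.1
    isOpenEmbedding_right := hr.1
    isLocalDiffeomorph_left := hl.2
    isLocalDiffeomorph_right := hr.2 }

/-- The connected sum of `M` and `N` along the coordinate balls `φ` and `ψ`: the interiors of the
two unit balls are removed, and the boundary spheres are identified by `φ⁻¹(x) ∼ ψ⁻¹(x)`, `|x| = 1`.
Its smooth structure across the sphere is the one for which `x ↦ φ⁻¹(x)` (`|x| ≥ 1`),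
`x ↦ ψ⁻¹(x / |x|²)` (`|x| ≤ 1`) is smooth. Equivalently, open collars of the spheres are kept on
both sides, and they are glued by `φ⁻¹(x) ∼ ψ⁻¹(x / |x|²)`. -/
abbrev ConnectedSum (φ : CoordBall E M p) (ψ : CoordBall E N q) : Type _ :=
  (connectedSumGluing φ ψ).Glued

end

/-- The coordinate ball `[1 : x]`, `|x| ≤ 1`, of `ℍℙⁿ`; its chart is `[w : q] ↦ q w⁻¹`, which is
defined where `w ≠ 0`, and its center is `[1 : 0 : … : 0]`. -/
noncomputable def HP.ball (n : ℕ) : CoordBall (Hn n) (HP n) ((HP.chart 0).symm 0) where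
  chart := HP.chart 0
  mem_maximalAtlas := IsManifold.subset_maximalAtlas (mem_range_self 0)
  mem_source := (HP.chart 0).map_target (mem_univ _)
  map_center := (HP.chart 0).right_inv (mem_univ _)
  closedBall_subset := subset_univ _

section

variable {n : ℕ} {M : Type*} [TopologicalSpace M] [T1Space M] [ChartedSpace (Hn n) M] {p : M}

/-- The open submanifold `M ∖ {p}`. -/
def punctured (p : M) : Opens M where
  carrier := {x | x ≠ p}
  is_open' := isOpen_ne

/-- The blow-up of the open set `φ(U)` of `ℍⁿ` at `0`. -/
def blowUpTarget (φ : CenteredChart (Hn n) M p) : Opens (Bl n) where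
  carrier := {x | x.π₁ ∈ φ.chart.target}
  is_open' := φ.chart.open_target.preimage Bl.continuous_π₁

/-- The complement of the exceptional set in the blow-up of `φ(U)` at `0`. -/
def blowUpOverlap (φ : CenteredChart (Hn n) M p) : Opens (Bl n) where
  carrier := {x | x.π₁ ∈ φ.chart.target ∧ x.π₁ ≠ 0}
  is_open' := (blowUpTarget φ).2.inter (isOpen_ne_fun Bl.continuous_π₁ continuous_const)

/-- The gluing of the blow-up: the point `x` of the blow-up of `φ(U)`, outside the exceptional set,
is identified with the point `φ⁻¹(π₁(x))` of `M ∖ {p}`. -/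
noncomputable def blowUpGluing [IsManifold 𝓘(ℝ, Hn n) ∞ M] (φ : CenteredChart (Hn n) M p) :
    SmoothGluing (Hn n) (blowUpOverlap φ) (punctured p) (blowUpTarget φ) :=
  let l : blowUpOverlap φ → punctured p := fun x => ⟨φ.chart.symm x.1.π₁, fun h =>
    x.2.2 (φ.chart.symm.injOn x.2.1 φ.zero_mem_target (h.trans φ.symm_zero.symm))⟩
  let r : blowUpOverlap φ → blowUpTarget φ := fun x => ⟨x.1, x.2.1⟩
  have hl : IsOpenEmbedding l ∧ IsLocalDiffeomorph 𝓘(ℝ, Hn n) 𝓘(ℝ, Hn n) ∞ l := by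
    refine isOpenEmbedding_isLocalDiffeomorph_of_restrict _ fun x₀ =>
      ⟨(Bl.puncturedEquiv x₀.1).trans φ.chart.symm, fun x hx => ⟨hx.2, hx.1⟩, ?_, ?_, fun _ => rfl⟩
    · exact φ.contMDiffOn_symm.comp Bl.contMDiff_π₁.contMDiffOn inter_subset_right
    · refine (Bl.contMDiffOn_puncturedEquiv_symm x₀.1).comp (φ.contMDiffOn.mono ?_) ?_
      · intro x hx
        simpa using hx.1
      · intro x hx
        exact hx.2
  have hr : IsOpenEmbedding r ∧ IsLocalDiffeomorph 𝓘(ℝ, Hn n) 𝓘(ℝ, Hn n) ∞ r := by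
    refine isOpenEmbedding_isLocalDiffeomorph_of_restrict _ fun _ =>
      ⟨OpenPartialHomeomorph.refl _, subset_univ _, contMDiffOn_id, contMDiffOn_id, fun _ => rfl⟩
  { left := l
    right := r
    isOpenEmbedding_left := hl.1
    isOpenEmbedding_right := hr.1
    isLocalDiffeomorph_left := hl.2
    isLocalDiffeomorph_right := hr.2 }

/-- The blow-up of `M` at `p`, with respect to a smooth chart `φ : U → ℍⁿ` with `φ(p) = 0`: the
point `p` is replaced by `ℍℙⁿ⁻¹`, the neighbourhood `U` of `p` being replaced by the blow-up of
`φ(U)` at `0`. -/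
abbrev BlowUp [IsManifold 𝓘(ℝ, Hn n) ∞ M] (φ : CenteredChart (Hn n) M p) : Type _ :=
  (blowUpGluing φ).Glued

end

/-! ## Diffeomorphisms of glued manifolds -/

namespace SmoothGluing

/-! Everything rests on one map, `Bl.toHP`: `(v, [a]) ↦ [⟨v, a⟩ : a]`, with `⟨v, a⟩ = ∑ v̄ⱼ aⱼ`. The
pairing is right linear in `a`, so the line does not depend on the representative. The map
identifies the blow-up of `ℍⁿ` at `0` with `ℍℙⁿ` minus the center `[1 : 0 : … : 0]`; its inverse is
`[w : a] ↦ (a w̄ / |a|², [a])`. Both formulas are smooth over `ℝ` in the standard charts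
(`Bl.contMDiff_toHP`, `Bl.contMDiffAt_ofHP`). The exceptional set `v = 0` goes to the hyperplane at
infinity `[0 : a]`.

For `v ≠ 0` one may take `a = v`, and the image is `[|v|² : v] = [1 : v / |v|²]`
(`Bl.toHP_of_π₁_ne_zero`). The inversion that glues collars in the connected sum is therefore
already contained in `toHP`: gluing `φ⁻¹(x)` to `[1 : x / |x|²]` amounts to gluing it to the point
of the blow-up over `x`.

It remains to match the open pieces. Since the chart of `ℍℙⁿ` is onto `ℍⁿ`, the piece of `M` in the
connected sum is exactly `M ∖ {p}` (`mem_side_ball_iff`), and the piece of `ℍℙⁿ` is exactly the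
image under `toHP` of the blow-up of `φ(U)` (`toHP_mem_side_iff`). Diffeomorphisms of the pieces
that match the identifications then glue (`SmoothGluing.congr`). -/

theorem pieceChart_apply {E : Type*} [NormedAddCommGroup E] {X G : Type*}
    [TopologicalSpace X] [ChartedSpace E X] [TopologicalSpace G]
    {f : X → G} (hf : IsOpenEmbedding f) (x y : X) :
    pieceChart (E := E) hf x (f y) = chartAt E x y := by
  have : Nonempty X := ⟨x⟩
  have h := (hf.toOpenPartialHomeomorph f).left_inv (x := y) (by simp)
  simp only [IsOpenEmbedding.toOpenPartialHomeomorph_apply] at h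
  simp [pieceChart, h]

variable {E : Type*} [NormedAddCommGroup E] [NormedSpace ℝ E]

/-- The inclusion of an open piece is smooth if the charts of the piece are charts of the whole. -/
theorem contMDiff_piece {X G : Type*} [TopologicalSpace X] [ChartedSpace E X]
    [IsManifold 𝓘(ℝ, E) ∞ X] [TopologicalSpace G] [ChartedSpace E G] [IsManifold 𝓘(ℝ, E) ∞ G]
    {f : X → G} (hf : IsOpenEmbedding f) (hG : ∀ x, pieceChart (E := E) hf x ∈ atlas E G) :
    ContMDiff 𝓘(ℝ, E) 𝓘(ℝ, E) ∞ f := by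
  intro x
  have hx : f x ∈ (pieceChart (E := E) hf x).source := mem_pieceChart_source hf x
  have h1 : ContMDiffAt 𝓘(ℝ, E) 𝓘(ℝ, E) ∞ (pieceChart (E := E) hf x).symm (chartAt E x x) := by
    refine contMDiffAt_symm_of_mem_maximalAtlas (IsManifold.subset_maximalAtlas (hG x)) ?_
    rw [← pieceChart_apply hf]
    exact (pieceChart hf x).map_source hx
  have h2 : ContMDiffAt 𝓘(ℝ, E) 𝓘(ℝ, E) ∞ (chartAt E x) x :=
    contMDiffAt_of_mem_maximalAtlas (IsManifold.chart_mem_maximalAtlas x) (mem_chart_source E x)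
  refine (h1.comp x h2).congr_of_eventuallyEq ?_
  filter_upwards [((pieceChart (E := E) hf x).open_source.preimage hf.continuous).mem_nhds hx]
    with y hy
  rw [Function.comp_apply, ← pieceChart_apply hf, (pieceChart hf x).left_inv hy]

/-- Smoothness at a point of an open piece can be checked on the piece. -/
theorem contMDiffAt_of_comp_piece {X G Z : Type*} [TopologicalSpace X] [ChartedSpace E X]
    [IsManifold 𝓘(ℝ, E) ∞ X] [TopologicalSpace G] [ChartedSpace E G] [IsManifold 𝓘(ℝ, E) ∞ G]
    [TopologicalSpace Z] [ChartedSpace E Z]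
    {f : X → G} (hf : IsOpenEmbedding f) (hG : ∀ x, pieceChart (E := E) hf x ∈ atlas E G)
    {g : G → Z} {x : X} (hg : ContMDiffAt 𝓘(ℝ, E) 𝓘(ℝ, E) ∞ (g ∘ f) x) :
    ContMDiffAt 𝓘(ℝ, E) 𝓘(ℝ, E) ∞ g (f x) := by
  have hx : f x ∈ (pieceChart (E := E) hf x).source := mem_pieceChart_source hf x
  have h1 : ContMDiffAt 𝓘(ℝ, E) 𝓘(ℝ, E) ∞ (pieceChart (E := E) hf x) (f x) :=
    contMDiffAt_of_mem_maximalAtlas (IsManifold.subset_maximalAtlas (hG x)) hx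
  have h2 : ContMDiffAt 𝓘(ℝ, E) 𝓘(ℝ, E) ∞ (chartAt E x).symm (chartAt E x x) :=
    contMDiffAt_symm_of_mem_maximalAtlas (IsManifold.chart_mem_maximalAtlas x)
      (mem_chart_target E x)
  -- This composite is a smooth local inverse of `f` at `f x`, so near `f x` the map `g` is `g ∘ f`
  -- composed with it.
  have h3 : ContMDiffAt 𝓘(ℝ, E) 𝓘(ℝ, E) ∞ ((chartAt E x).symm ∘ pieceChart (E := E) hf x)
      (f x) := by
    refine ContMDiffAt.comp (f x) ?_ h1
    rwa [pieceChart_apply]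
  have h4 : ((chartAt E x).symm ∘ pieceChart (E := E) hf x) (f x) = x := by
    rw [Function.comp_apply, pieceChart_apply, (chartAt E x).left_inv (mem_chart_source E x)]
  refine (ContMDiffAt.comp (g := g ∘ f) (f x) (by rwa [h4]) h3).congr_of_eventuallyEq ?_
  filter_upwards [hf.isOpenMap _ (chartAt E x).open_source |>.mem_nhds
    (mem_image_of_mem f (mem_chart_source E x))] with y hy
  obtain ⟨u, hu, rfl⟩ := hy
  simp only [Function.comp_apply, pieceChart_apply, (chartAt E x).left_inv hu]

variable {W A B W' A' B' : Type*}
  [TopologicalSpace W] [ChartedSpace E W] [TopologicalSpace A] [ChartedSpace E A]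
  [TopologicalSpace B] [ChartedSpace E B]
  [TopologicalSpace W'] [ChartedSpace E W'] [TopologicalSpace A'] [ChartedSpace E A']
  [TopologicalSpace B'] [ChartedSpace E B']

/-- The map between glued spaces induced by compatible maps between the pieces. -/
def map (D : SmoothGluing E W A B) (D' : SmoothGluing E W' A' B') (f : A → A') (g : B → B')
    (h : ∀ a b, D.inl a = D.inr b → D'.inl (f a) = D'.inr (g b)) : D.Glued → D'.Glued :=
  Quotient.lift (Sum.elim (D'.inl ∘ f) (D'.inr ∘ g)) (by
    rintro _ _ (rfl | ⟨w, rfl, rfl⟩ | ⟨w, rfl, rfl⟩)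
    · rfl
    · exact h _ _ (D.inl_eq_inr_iff.2 ⟨w, rfl, rfl⟩)
    · exact (h _ _ (D.inl_eq_inr_iff.2 ⟨w, rfl, rfl⟩)).symm)

theorem exists_inl_or_inr (D : SmoothGluing E W A B) (x : D.Glued) :
    (∃ a, D.inl a = x) ∨ ∃ b, D.inr b = x := by
  induction x using Quotient.inductionOn with
  | h y => cases y with
    | inl a => exact .inl ⟨a, rfl⟩
    | inr b => exact .inr ⟨b, rfl⟩

variable [IsManifold 𝓘(ℝ, E) ∞ A] [IsManifold 𝓘(ℝ, E) ∞ B]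
  [IsManifold 𝓘(ℝ, E) ∞ A'] [IsManifold 𝓘(ℝ, E) ∞ B']

/-- Smoothness is local and the two open pieces cover the glued space; on each piece the map is `f`
or `g` followed by an inclusion, by definition of the quotient lift. -/
theorem contMDiff_map (D : SmoothGluing E W A B) (D' : SmoothGluing E W' A' B') {f : A → A'}
    {g : B → B'} (h : ∀ a b, D.inl a = D.inr b → D'.inl (f a) = D'.inr (g b))
    (hf : ContMDiff 𝓘(ℝ, E) 𝓘(ℝ, E) ∞ f) (hg : ContMDiff 𝓘(ℝ, E) 𝓘(ℝ, E) ∞ g) :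
    ContMDiff 𝓘(ℝ, E) 𝓘(ℝ, E) ∞ (map D D' f g h) := by
  intro x
  rcases D.exists_inl_or_inr x with ⟨a, rfl⟩ | ⟨b, rfl⟩
  · refine contMDiffAt_of_comp_piece D.isOpenEmbedding_inl (fun x => mem_union_left _ (mem_range_self x)) ?_
    exact ((contMDiff_piece D'.isOpenEmbedding_inl fun x => mem_union_left _ (mem_range_self x)).comp hf) a
  · refine contMDiffAt_of_comp_piece D.isOpenEmbedding_inr (fun x => mem_union_right _ (mem_range_self x)) ?_
    exact ((contMDiff_piece D'.isOpenEmbedding_inr fun x => mem_union_right _ (mem_range_self x)).comp hg) b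

/-- Diffeomorphisms between the pieces which respect the identifications induce a diffeomorphism
between the glued manifolds. -/
noncomputable def congr (D : SmoothGluing E W A B) (D' : SmoothGluing E W' A' B')
    (f : Diffeomorph 𝓘(ℝ, E) 𝓘(ℝ, E) A A' ∞) (g : Diffeomorph 𝓘(ℝ, E) 𝓘(ℝ, E) B B' ∞)
    (h : ∀ a b, D.inl a = D.inr b ↔ D'.inl (f a) = D'.inr (g b)) :
    Diffeomorph 𝓘(ℝ, E) 𝓘(ℝ, E) D.Glued D'.Glued ∞ :=
  -- The reverse implication in `h` is what lets the inverses descend to the quotients.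
  have h' : ∀ a b, D'.inl a = D'.inr b → D.inl (f.symm a) = D.inr (g.symm b) :=
    fun a b hab => (h _ _).2 (by simpa using hab)
  { toFun := map D D' f g fun a b => (h a b).1
    invFun := map D' D f.symm g.symm h'
    left_inv x := by
      rcases D.exists_inl_or_inr x with ⟨a, rfl⟩ | ⟨b, rfl⟩
      · exact congrArg D.inl (f.symm_apply_apply a)
      · exact congrArg D.inr (g.symm_apply_apply b)
    right_inv x := by
      rcases D'.exists_inl_or_inr x with ⟨a, rfl⟩ | ⟨b, rfl⟩
      · exact congrArg D'.inl (f.apply_symm_apply a)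
      · exact congrArg D'.inr (g.apply_symm_apply b)
    contMDiff_toFun := contMDiff_map D D' (fun a b => (h a b).1) f.contMDiff g.contMDiff
    contMDiff_invFun := contMDiff_map D' D h' f.symm.contMDiff g.symm.contMDiff }

end SmoothGluing

/-- A diffeomorphism between open subsets of two manifolds restricts to a diffeomorphism between
corresponding open submanifolds. -/
theorem exists_diffeomorph_of_restrict {E : Type*} [NormedAddCommGroup E]
    [NormedSpace ℝ E] {X Y : Type*} [TopologicalSpace X] [ChartedSpace E X]
    [TopologicalSpace Y] [ChartedSpace E Y] {U : Opens X} {V : Opens Y} (i : U → V)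
    (hΦ : U → ∃ Φ : OpenPartialHomeomorph X Y, (U : Set X) ⊆ Φ.source ∧
      ContMDiffOn 𝓘(ℝ, E) 𝓘(ℝ, E) ∞ Φ Φ.source ∧
      ContMDiffOn 𝓘(ℝ, E) 𝓘(ℝ, E) ∞ Φ.symm Φ.target ∧ ∀ u : U, (i u : Y) = Φ u)
    (hi : Function.Surjective i) :
    ∃ e : Diffeomorph 𝓘(ℝ, E) 𝓘(ℝ, E) U V ∞, ∀ u, e u = i u := by
  obtain ⟨h, h'⟩ := isOpenEmbedding_isLocalDiffeomorph_of_restrict i hΦ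
  exact ⟨h'.diffeomorphOfBijective ⟨h.injective, hi⟩, fun _ => rfl⟩

/-! ## Existence of coordinate balls -/

/-- The preferred chart at `p` is composed with an affine map: the value `c` at `p` is moved to `0`,
and a ball of radius `ε` inside the target is dilated to radius `2`, which leaves room for the
closed unit ball. -/
theorem nonempty_coordBall (E : Type*) [NormedAddCommGroup E] [NormedSpace ℝ E] {M : Type*}
    [TopologicalSpace M] [ChartedSpace E M] [IsManifold 𝓘(ℝ, E) ∞ M] (p : M) :
    Nonempty (CoordBall E M p) := by
  set c := chartAt E p p with hc
  obtain ⟨ε, hε, hball⟩ := Metric.isOpen_iff.1 (chartAt E p).open_target c (mem_chart_target E p)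
  have hδ : (2 / ε : ℝ) ≠ 0 := by positivity
  let T : E ≃ₜ E := (Homeomorph.addRight (-c)).trans (Homeomorph.smulOfNeZero (2 / ε) hδ)
  have hT : ∀ x, T x = (2 / ε) • (x + -c) := fun _ => rfl
  have hTs : ∀ x, T.symm x = (2 / ε)⁻¹ • x + - -c := fun _ => rfl
  have hT1 : ContDiff ℝ ∞ T := by
    change ContDiff ℝ ∞ fun x => (2 / ε) • (x + -c)
    fun_prop
  have hT2 : ContDiff ℝ ∞ T.symm := by
    change ContDiff ℝ ∞ fun x => (2 / ε)⁻¹ • x + - -c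
    fun_prop
  have hmem := IsManifold.chart_mem_maximalAtlas (I := 𝓘(ℝ, E)) (n := ∞) p
  refine ⟨⟨⟨(chartAt E p).transHomeomorph T, ?_, mem_chart_source E p, ?_⟩, ?_⟩⟩
  · refine (IsManifold.mem_maximalAtlas_iff_contMDiffOn _).2 ⟨?_, ?_⟩
    · exact hT1.contMDiff.comp_contMDiffOn (contMDiffOn_of_mem_maximalAtlas hmem)
    · exact (contMDiffOn_symm_of_mem_maximalAtlas hmem).comp hT2.contMDiff.contMDiffOn
        fun _ h => h
  · change T c = 0
    rw [hT, add_neg_cancel, smul_zero]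
  · intro x hx
    change T.symm x ∈ (chartAt E p).target
    apply hball
    rw [mem_closedBall_zero_iff] at hx
    rw [hTs, neg_neg, mem_ball_iff_norm, add_sub_cancel_right, norm_smul, inv_div, Real.norm_eq_abs,
      abs_of_pos (by positivity)]
    -- What remains is `ε / 2 * ‖x‖ < ε`, from `‖x‖ ≤ 1` and `ε > 0`.
    nlinarith

/-! ## The complement of a point in `ℍℙⁿ` is the blow-up of `ℍⁿ` -/

/-- Conjugation is linear over `ℝ` in finite dimension. `Quaternion.starAe` takes values in the
opposite algebra, hence the correction by `MulOpposite.opLinearEquiv`. -/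
theorem contDiff_quaternion_star : ContDiff ℝ ∞ (star : ℍ[ℝ] → ℍ[ℝ]) :=
  (LinearMap.toContinuousLinearMap
    (Quaternion.starAe.toLinearEquiv.trans (MulOpposite.opLinearEquiv ℝ).symm).toLinearMap).contDiff

namespace HP

variable {n : ℕ}

theorem contMDiffAt_chart {i : Fin (n + 1)} {x : HP n} (hx : x ∈ QP.affine i) :
    ContMDiffAt 𝓘(ℝ, Hn n) 𝓘(ℝ, Hn n) ∞ (chart i) x :=
  contMDiffAt_of_mem_maximalAtlas (IsManifold.subset_maximalAtlas (mem_range_self i)) hx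

theorem contMDiff_chart_symm (i : Fin (n + 1)) :
    ContMDiff 𝓘(ℝ, Hn n) 𝓘(ℝ, Hn n) ∞ (chart (n := n) i).symm := fun _ =>
  contMDiffAt_symm_of_mem_maximalAtlas (IsManifold.subset_maximalAtlas (mem_range_self i))
    (mem_univ _)

/-- The quotient map `ℍⁿ⁺¹ ∖ {0} → ℍℙⁿ` is smooth. -/
theorem contMDiff_mk {f : Hn n → Hn (n + 1)} (hf : ContDiff ℝ ∞ f) (h0 : ∀ b, f b ≠ 0) :
    ContMDiff 𝓘(ℝ, Hn n) 𝓘(ℝ, Hn n) ∞ fun b => (Projectivization.mk _ (f b) (h0 b) : HP n) := by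
  intro b
  obtain ⟨j, hj⟩ := QP.exists_mem_affine (Projectivization.mk _ (f b) (h0 b) : HP n)
  have hopen : {b | (Projectivization.mk _ (f b) (h0 b) : HP n) ∈ QP.affine j} ∈ 𝓝 b :=
    ((QP.isOpen_affine j).preimage (QP.continuous_mk hf.continuous h0)).mem_nhds hj
  have hF : ContDiffAt ℝ ∞
      (fun b => chart j (Projectivization.mk _ (f b) (h0 b))) b := by
    rw [contDiffAt_piLp]
    intro k
    have hc : ∀ l, ContDiff ℝ ∞ fun b => f b l := fun l => (contDiff_piLp_apply 2).comp hf
    have hi : ContDiffAt ℝ ∞ (fun b => (f b j)⁻¹) b :=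
      (contDiffAt_quaternion_inv hj).comp b (hc j).contDiffAt
    exact (hc _).contDiffAt.mul hi
  refine ((contMDiff_chart_symm j).contMDiffAt.comp b hF.contMDiffAt).congr_of_eventuallyEq ?_
  filter_upwards [hopen] with b hb
  exact ((chart j).left_inv hb).symm

/-- The vector `(a₁, …, aₙ)` obtained from `(a₀, a₁, …, aₙ)`. -/
noncomputable def tail (z : Hn (n + 1)) : Hn n := WithLp.toLp 2 fun j => z j.succ

theorem tail_smul (t : ℍ[ℝ]ᵐᵒᵖ) (z : Hn (n + 1)) : tail (t • z) = t • tail z := rfl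

theorem contDiff_tail : ContDiff ℝ ∞ (tail (n := n)) := by
  rw [contDiff_piLp]
  exact fun j => contDiff_piLp_apply 2

/-- Thus the center is the only line to which the projection `[w : a] ↦ [a]` does not extend. When
the tail vanishes the coordinate `0` cannot, so chart `0` applies. -/
theorem mk_eq_center {z : Hn (n + 1)} (hz : z ≠ 0) (h : tail z = 0) :
    (Projectivization.mk _ z hz : HP n) = (chart 0).symm 0 := by
  have hz' : ∀ j : Fin n, z j.succ = 0 := fun j => congrArg (fun v : Hn n => v j) h
  have h0 : z 0 ≠ 0 := by
    intro h0
    apply hz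
    ext1 j
    exact Fin.cases h0 hz' j
  rw [← (chart 0).left_inv (x := Projectivization.mk _ z hz) h0]
  congr 1
  ext1 j
  change z (Fin.succAbove 0 j) * (z 0)⁻¹ = 0
  rw [Fin.zero_succAbove, hz', zero_mul]

end HP

namespace Bl

variable {n : ℕ}

theorem contMDiff_ofCoord (i : Fin n) :
    ContMDiff 𝓘(ℝ, Hn n) 𝓘(ℝ, Hn n) ∞ (ofCoord (n := n) i) := fun _ =>
  contMDiffAt_symm_of_mem_maximalAtlas (e := chart i)
    (IsManifold.subset_maximalAtlas (mem_range_self i)) (mem_univ _)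

theorem contMDiffAt_chart {i : Fin n} {x : Bl n} (hx : x.π₂ ∈ QP.affine i) :
    ContMDiffAt 𝓘(ℝ, Hn n) 𝓘(ℝ, Hn n) ∞ (chart i) x :=
  contMDiffAt_of_mem_maximalAtlas (IsManifold.subset_maximalAtlas (mem_range_self i)) hx

/-- The vector `(⟨v, a⟩, a)`. -/
noncomputable def vec (v a : Hn n) : Hn (n + 1) :=
  WithLp.toLp 2 (Fin.cons (∑ j, star (v j) * a j) a.ofLp : Fin (n + 1) → ℍ[ℝ])

theorem vec_zero (v a : Hn n) : vec v a 0 = ∑ j, star (v j) * a j := rfl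

theorem vec_succ (v a : Hn n) (j : Fin n) : vec v a j.succ = a j := rfl

theorem tail_vec (v a : Hn n) : HP.tail (vec v a) = a := rfl

/-- Conjugation falls on `v`, so scalars to the right of `a` factor out of the pairing. This makes
`[⟨v, a⟩ : a]` depend only on the line of `a`. -/
theorem vec_smul_right (v a : Hn n) (t : ℍ[ℝ]ᵐᵒᵖ) : vec v (t • a) = t • vec v a := by
  ext1 j
  refine Fin.cases ?_ (fun j => ?_) j
  · simp only [QP.smul_coord, vec_zero, Finset.sum_mul, mul_assoc]
  · simp only [QP.smul_coord, vec_succ]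

theorem vec_ne_zero (v : Hn n) {a : Hn n} (ha : a ≠ 0) : vec v a ≠ 0 := by
  intro h
  apply ha
  rw [← tail_vec v a, h]
  rfl

theorem sum_star_mul_self (a : Hn n) : ∑ j, star (a j) * a j = ((‖a‖ ^ 2 : ℝ) : ℍ[ℝ]) := by
  rw [PiLp.norm_sq_eq_of_L2]
  change _ = algebraMap ℝ ℍ[ℝ] (∑ j, ‖a j‖ ^ 2)
  rw [map_sum]
  refine Finset.sum_congr rfl fun j _ => ?_
  rw [Quaternion.star_mul_self, Quaternion.normSq_eq_norm_mul_self, sq]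
  rfl

/-- For `v = a t` the pairing is `t̄ ∑ āⱼ aⱼ`. The coefficient `t` can thus be recovered from it,
which is the source of the inverse formula. -/
theorem vec_smul_self_zero (a : Hn n) (t : ℍ[ℝ]) :
    vec (MulOpposite.op t • a) a 0 = ‖a‖ ^ 2 • star t := by
  simp only [vec_zero, QP.smul_coord, MulOpposite.unop_op, star_mul, mul_assoc]
  rw [← Finset.mul_sum, sum_star_mul_self, Quaternion.mul_coe_eq_smul]

/-- The map `(v, [a]) ↦ [⟨v, a⟩ : a]` from the blow-up of `ℍⁿ` to `ℍℙⁿ`. -/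
noncomputable def toHP (y : Bl n) : HP n :=
  Projectivization.mk _ (vec y.π₁ y.π₂.rep) (vec_ne_zero _ y.π₂.rep_nonzero)

/-- Replaces the arbitrarily chosen `rep` by any convenient vector spanning the line. -/
theorem toHP_eq (y : Bl n) {a : Hn n} (ha : a ≠ 0) (h : y.π₂ = Projectivization.mk _ a ha) :
    toHP y = Projectivization.mk _ (vec y.π₁ a) (vec_ne_zero _ ha) := by
  rw [← y.π₂.mk_rep, Projectivization.mk_eq_mk_iff'] at h
  obtain ⟨t, ht⟩ := h
  refine (Projectivization.mk_eq_mk_iff' _ _ _ _ _).2 ⟨t, ?_⟩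
  rw [← vec_smul_right, ht]

theorem contDiff_vec {f g : Hn n → Hn n} (hf : ContDiff ℝ ∞ f) (hg : ContDiff ℝ ∞ g) :
    ContDiff ℝ ∞ fun b => vec (f b) (g b) := by
  rw [contDiff_piLp]
  intro j
  refine Fin.cases ?_ (fun j => ?_) j
  · simp only [vec_zero]
    refine ContDiff.sum fun j _ => ContDiff.mul ?_ ((contDiff_piLp_apply 2).comp hg)
    exact contDiff_quaternion_star.comp ((contDiff_piLp_apply 2).comp hf)
  · change ContDiff ℝ ∞ fun b => g b j
    exact (contDiff_piLp_apply 2).comp hg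

/-- Over the `i`-th chart, `replaceOne i b` spans the line and depends smoothly on the coordinates
`b`, so `toHP` is there the class of a smooth nonvanishing vector. -/
theorem contMDiff_toHP : ContMDiff 𝓘(ℝ, Hn n) 𝓘(ℝ, Hn n) ∞ (toHP (n := n)) := by
  intro y
  obtain ⟨i, hi⟩ := QP.exists_mem_affine y.π₂
  have h := HP.contMDiff_mk (contDiff_vec (contDiff_point i) (contDiff_replaceOne i))
    fun b => vec_ne_zero _ (QP.ne_zero_of_apply_eq_one (replaceOne_self i b))
  refine (h.contMDiffAt.comp y (contMDiffAt_chart hi)).congr_of_eventuallyEq ?_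
  filter_upwards [(chart i).open_source.mem_nhds hi] with u hu
  conv_lhs => rw [← (chart i).left_inv hu]
  exact toHP_eq (ofCoord i (chart i u)) _ rfl

/-- The point `(a w̄ / |a|², [a])` of the blow-up, for `z = (w, a)` with `a ≠ 0`. -/
noncomputable def ofVec (z : Hn (n + 1)) (h : HP.tail z ≠ 0) : Bl n :=
  ⟨(MulOpposite.op ((‖HP.tail z‖ ^ 2)⁻¹ • star (z 0)) • HP.tail z, Projectivization.mk _ _ h),
    Submodule.smul_mem _ _ (Submodule.mem_span_singleton_self _)⟩

/-- In `a w̄ / |a|²`, passing to `(w t, a t)` yields `a t t̄ w̄ = |t|² a w̄` in the numerator, and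
the factor `|t|²` cancels with that of `|a t|²`. -/
theorem ofVec_smul {t : ℍ[ℝ]ᵐᵒᵖ} {z : Hn (n + 1)} (h : HP.tail z ≠ 0)
    (h' : HP.tail (t • z) ≠ 0) : ofVec (t • z) h' = ofVec z h := by
  have ht : t.unop ≠ 0 := by
    intro ht
    apply h'
    rw [← MulOpposite.op_unop t, ht, MulOpposite.op_zero, zero_smul]
    rfl
  refine Subtype.ext (Prod.ext ?_ ((Projectivization.mk_eq_mk_iff' _ _ _ _ _).2 ⟨t, rfl⟩))
  have hn : ‖HP.tail (t • z)‖ ^ 2 = ‖t.unop‖ ^ 2 * ‖HP.tail z‖ ^ 2 := by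
    simp only [HP.tail_smul, PiLp.norm_sq_eq_of_L2, QP.smul_coord, norm_mul, mul_pow,
      Finset.mul_sum]
    exact Finset.sum_congr rfl fun _ _ => mul_comm _ _
  have ht' : t.unop * star t.unop = ((‖t.unop‖ ^ 2 : ℝ) : ℍ[ℝ]) := by
    rw [Quaternion.self_mul_star, Quaternion.normSq_eq_norm_mul_self, sq]
  ext1 j
  change HP.tail z j * t.unop * ((‖HP.tail (t • z)‖ ^ 2)⁻¹ • star (z 0 * t.unop)) =
    HP.tail z j * ((‖HP.tail z‖ ^ 2)⁻¹ • star (z 0))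
  rw [hn, star_mul, mul_smul_comm, mul_assoc, ← mul_assoc t.unop, ht', Quaternion.coe_mul_eq_smul,
    mul_smul_comm, smul_smul, mul_smul_comm, mul_inv, mul_right_comm, inv_mul_cancel₀, one_mul]
  exact pow_ne_zero 2 (norm_ne_zero_iff.2 ht)

/-- The inverse of `toHP` (with the junk value `x₀` at `[1 : 0 : … : 0]`). -/
noncomputable def ofHP (x₀ : Bl n) (x : HP n) : Bl n :=
  open Classical in
  if h : HP.tail x.rep ≠ 0 then ofVec x.rep h else x₀

theorem ofHP_mk (x₀ : Bl n) {z : Hn (n + 1)} (hz : z ≠ 0) (h : HP.tail z ≠ 0) :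
    ofHP x₀ (Projectivization.mk _ z hz) = ofVec z h := by
  obtain ⟨t, ht⟩ := (Projectivization.mk_eq_mk_iff' _ _ _ _ _).1
    (Projectivization.mk_rep (Projectivization.mk ℍ[ℝ]ᵐᵒᵖ z hz)).symm
  have h' : HP.tail (Projectivization.mk ℍ[ℝ]ᵐᵒᵖ z hz).rep ≠ 0 := by
    intro h'
    apply h
    rw [← ht, HP.tail_smul, h', smul_zero]
  rw [ofHP, dif_pos h']
  conv_rhs => enter [1]; rw [← ht]
  exact (ofVec_smul h' (by rwa [ht])).symm

/-- A point of the blow-up has the form `(a t, [a])`; its pairing is `|a|² t̄`, so conjugating and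
dividing by `|a|²` returns `t`. -/
theorem ofHP_toHP (x₀ y : Bl n) : ofHP x₀ (toHP y) = y := by
  obtain ⟨a, ha, hl⟩ := QP.exists_rep y.π₂
  have hy := y.π₁_mem
  rw [← hl] at hy
  obtain ⟨t, ht⟩ := Submodule.mem_span_singleton.1 hy
  rw [toHP_eq _ ha hl.symm, ofHP_mk x₀ _ (show HP.tail (vec _ a) ≠ 0 from ha)]
  refine Subtype.ext (Prod.ext ?_ hl)
  change MulOpposite.op ((‖a‖ ^ 2)⁻¹ • star (vec y.π₁ a 0)) • a = y.π₁
  change t • a = y.π₁ at ht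
  rw [← ht, ← MulOpposite.op_unop t, vec_smul_self_zero, Quaternion.star_smul, star_star, smul_smul,
    inv_mul_cancel₀ (pow_ne_zero 2 (norm_ne_zero_iff.2 ha)), one_smul]

/-- The pairing of `a w̄ / |a|²` with `a` is `w`, so even the representative `(w, a)` is recovered.
-/
theorem toHP_ofVec {z : Hn (n + 1)} (hz : z ≠ 0) (h : HP.tail z ≠ 0) :
    toHP (ofVec z h) = Projectivization.mk _ z hz := by
  rw [toHP_eq _ h rfl]
  congr 1
  ext1 j
  refine Fin.cases ?_ (fun j => rfl) j
  refine (vec_smul_self_zero _ _).trans ?_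
  rw [Quaternion.star_smul, star_star, smul_smul,
    mul_inv_cancel₀ (pow_ne_zero 2 (norm_ne_zero_iff.2 h)), one_smul]

theorem exists_tail_ne_zero {x : HP n} (hx : x ≠ (HP.chart 0).symm 0) :
    ∃ z hz, HP.tail z ≠ 0 ∧ Projectivization.mk ℍ[ℝ]ᵐᵒᵖ z hz = x := by
  obtain ⟨z, hz, rfl⟩ := QP.exists_rep x
  exact ⟨z, hz, fun h => hx (HP.mk_eq_center hz h), rfl⟩

/-- The image is spanned by a vector with tail `a ≠ 0`, while every vector on the central line has
tail `0`. -/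
theorem toHP_ne_center (y : Bl n) : toHP y ≠ (HP.chart 0).symm 0 := by
  obtain ⟨a, ha, hl⟩ := QP.exists_rep y.π₂
  rw [toHP_eq _ ha hl.symm]
  intro h
  obtain ⟨t, ht⟩ := (Projectivization.mk_eq_mk_iff' _ _ _ _ _).1 h
  apply ha
  rw [← tail_vec y.π₁ a]
  refine (congrArg HP.tail ht).symm.trans ?_
  rw [HP.tail_smul]
  have : HP.tail (HP.insertOne 0 (0 : Hn n)) = 0 := by
    ext1 j
    refine Eq.trans ?_ (HP.insertOne_succAbove 0 (0 : Hn n) j)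
    rw [Fin.zero_succAbove]
    rfl
  rw [this, smul_zero]

theorem contMDiffAt_ofHP (x₀ : Bl n) {x : HP n} (hx : x ≠ (HP.chart 0).symm 0) :
    ContMDiffAt 𝓘(ℝ, Hn n) 𝓘(ℝ, Hn n) ∞ (ofHP x₀) x := by
  obtain ⟨z, hz, h, rfl⟩ := exists_tail_ne_zero hx
  obtain ⟨i, hi⟩ : ∃ i : Fin n, z i.succ ≠ 0 := by
    by_contra! hi
    exact h (by ext1 j; exact hi j)
  have hsucc : ∀ b : Hn n, HP.tail (HP.insertOne i.succ b) i = 1 := fun b =>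
    HP.insertOne_self i.succ b
  have ht : ∀ b : Hn n, HP.tail (HP.insertOne i.succ b) ≠ 0 := fun b =>
    QP.ne_zero_of_apply_eq_one (hsucc b)
  have hins : ContDiff ℝ ∞ fun b : Hn n => HP.insertOne i.succ b := HP.contDiff_insertOne _
  have htail : ContDiff ℝ ∞ fun b : Hn n => HP.tail (HP.insertOne i.succ b) :=
    HP.contDiff_tail.comp hins
  -- Chart `i.succ` of `ℍℙⁿ` is paired with chart `i` of the blow-up: the normalized representative
  -- `(w, a)` then has `aᵢ = 1`. The new coordinates are `aₖ` for `k ≠ i`, and `w̄ / |a|²` at the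
  -- place `i`.
  have hF : ContDiff ℝ ∞ fun b : Hn n => chart i (ofVec (HP.insertOne i.succ b) (ht b)) := by
    rw [contDiff_piLp]
    intro k
    by_cases hk : k = i
    · subst hk
      have : ∀ b, chart k (ofVec (HP.insertOne k.succ b) (ht b)) k =
          (‖HP.tail (HP.insertOne k.succ b)‖ ^ 2)⁻¹ • star (HP.insertOne k.succ b 0) := by
        intro b
        refine (Function.update_self _ _ _).trans ?_
        refine (QP.smul_coord _ _ _).trans ?_
        rw [hsucc, one_mul, MulOpposite.unop_op]
      simp only [this]
      refine ContDiff.smul (ContDiff.inv (htail.norm_sq ℝ) fun b =>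
        pow_ne_zero 2 (norm_ne_zero_iff.2 (ht b))) ?_
      exact contDiff_quaternion_star.comp ((contDiff_piLp_apply 2).comp hins)
    · have : ∀ b, chart i (ofVec (HP.insertOne i.succ b) (ht b)) k =
          HP.tail (HP.insertOne i.succ b) k := by
        intro b
        refine (Function.update_of_ne hk _ _).trans ?_
        refine (QP.normalize_mk (ht b) k).trans ?_
        rw [hsucc, inv_one, mul_one]
      simp only [this]
      exact (contDiff_piLp_apply 2).comp htail
  have hmem : (Projectivization.mk _ z hz : HP n) ∈ QP.affine i.succ := hi
  refine (ContMDiffAt.comp _ ((contMDiff_ofCoord i).comp hF.contMDiff).contMDiffAt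
    (HP.contMDiffAt_chart hmem)).congr_of_eventuallyEq ?_
  filter_upwards [(HP.chart i.succ).open_source.mem_nhds hmem] with u hu
  conv_lhs => rw [← (HP.chart i.succ).left_inv hu]
  refine (ofHP_mk x₀ _ (ht _)).trans ?_
  refine ((chart i).left_inv ?_).symm
  change HP.tail (HP.insertOne i.succ _) i ≠ 0
  rw [hsucc]
  exact one_ne_zero

/-- The blow-up of `ℍⁿ` at `0` is diffeomorphic to the complement of a point in `ℍℙⁿ`. -/
noncomputable def equivHP (x₀ : Bl n) : OpenPartialHomeomorph (Bl n) (HP n) where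
  toFun := toHP
  invFun := ofHP x₀
  source := univ
  target := {x | x ≠ (HP.chart 0).symm 0}
  map_source' y _ := toHP_ne_center y
  map_target' _ _ := mem_univ _
  left_inv' y _ := ofHP_toHP x₀ y
  right_inv' x hx := by
    obtain ⟨z, hz, h, rfl⟩ := exists_tail_ne_zero hx
    rw [ofHP_mk x₀ hz h, toHP_ofVec hz h]
  open_source := isOpen_univ
  open_target := isOpen_ne
  continuousOn_toFun := contMDiff_toHP.continuous.continuousOn
  continuousOn_invFun _ hx := (contMDiffAt_ofHP x₀ hx).continuousAt.continuousWithinAt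

/-- Off the exceptional set the line is spanned by `v = π₁ y` itself, and `⟨v, v⟩ = |v|²`. This is
where the inversion of the connected sum appears. -/
theorem toHP_of_π₁_ne_zero {y : Bl n} (h : y.π₁ ≠ 0) :
    toHP y = (HP.chart 0).symm (ConnectedSum.inv y.π₁) := by
  have hl : y.π₂ = Projectivization.mk _ y.π₁ h := by
    obtain ⟨a, ha, hl⟩ := QP.exists_rep y.π₂
    have hy := y.π₁_mem
    rw [← hl] at hy ⊢
    exact ((Projectivization.mk_eq_mk_iff' _ _ _ _ _).2 (Submodule.mem_span_singleton.1 hy)).symm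
  rw [toHP_eq y h hl]
  have hn : ‖y.π₁‖ ^ 2 ≠ 0 := pow_ne_zero 2 (norm_ne_zero_iff.2 h)
  -- The scalar `|v|²` carries `(1, v / |v|²)` to `(|v|², v)`.
  refine (Projectivization.mk_eq_mk_iff' _ _ _ _ _).2
    ⟨MulOpposite.op ((‖y.π₁‖ ^ 2 : ℝ) : ℍ[ℝ]), ?_⟩
  ext1 j
  rw [QP.smul_coord, MulOpposite.unop_op, Quaternion.mul_coe_eq_smul]
  refine Fin.cases ?_ (fun j => ?_) j
  · rw [HP.insertOne_self, vec_zero, sum_star_mul_self, ← Quaternion.coe_mul_eq_smul, mul_one]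
  · rw [vec_succ, ← Fin.zero_succAbove, HP.insertOne_succAbove]
    change ‖y.π₁‖ ^ 2 • ((‖y.π₁‖ ^ 2)⁻¹ • y.π₁ j) = _
    rw [smul_smul, mul_inv_cancel₀ hn, one_smul]

/-- If `v = 0` the pairing vanishes, so the image lies at infinity, outside the domain of chart `0`.
-/
theorem toHP_ne_of_π₁_eq_zero {y : Bl n} (h : y.π₁ = 0) (x : Hn n) :
    (HP.chart 0).symm x ≠ toHP y := by
  intro hx
  have h1 : toHP y ∈ QP.affine 0 := hx ▸ (HP.chart 0).map_target (mem_univ x)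
  apply (QP.mk_mem_affine _).1 h1
  rw [vec_zero, h]
  simp

end Bl

/-! ### Matching the pieces and the identifications of the two gluings -/

section

variable {n : ℕ} {M : Type*} [TopologicalSpace M] [ChartedSpace (Hn n) M] {p : M}

open ConnectedSum

/-- The removed points are the `[1 : x]` with `|x| ≤ 1` and either `x = 0` or `x / |x|²` outside
`φ(U)`. Points at infinity are never removed and lie over `0 ∈ φ(U)`; elsewhere `x = v / |v|²`,
whose inversion is `v`. -/
theorem toHP_mem_side_iff (φ : CoordBall (Hn n) M p) {y : Bl n} :
    y.toHP ∈ side (HP.ball n) φ ↔ y.π₁ ∈ φ.chart.target := by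
  rw [← not_iff_not]
  change ¬ y.toHP ∉ (HP.chart 0).symm '' _ ↔ _
  rw [not_not]
  rcases eq_or_ne y.π₁ 0 with h | h
  · rw [h]
    refine iff_of_false ?_ (not_not.2 φ.zero_mem_target)
    rintro ⟨x, -, hx⟩
    exact Bl.toHP_ne_of_π₁_eq_zero h x hx
  · rw [Bl.toHP_of_π₁_ne_zero h]
    constructor
    · rintro ⟨x, hx, hx'⟩ hy
      obtain rfl : x = ConnectedSum.inv y.π₁ :=
        (HP.chart 0).symm.injOn (mem_univ _) (mem_univ _) hx'
      exact hx.2 ⟨mem_univ _, inv_ne_zero h, by rwa [ConnectedSum.inv_inv]⟩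
    · intro hy
      refine mem_image_of_mem _ ⟨?_, fun h' => hy ?_⟩
      -- The condition `|x| ≤ 1` is automatic: `φ(U)` contains the closed unit ball, so a vector
      -- outside `φ(U)` has norm above `1` and its inversion has norm below `1`.
      · have h1 : 1 < ‖y.π₁‖ := by
          by_contra! h1
          exact hy (φ.closedBall_subset (mem_closedBall_zero_iff.2 h1))
        rw [mem_closedBall_zero_iff, ConnectedSum.inv, norm_smul, norm_inv, norm_pow, norm_norm, sq,
          mul_inv, mul_assoc, inv_mul_cancel₀ (by positivity), mul_one]
        exact inv_le_one_of_one_le₀ h1.le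
      · have := h'.2.2
        rwa [ConnectedSum.inv_inv] at this

/-- The overlap never contains `0`, so the center is among the removed points. Needed for
surjectivity, since `toHP` misses exactly the center. -/
theorem ne_center_of_mem_side (φ : CoordBall (Hn n) M p) {x : HP n}
    (hx : x ∈ side (HP.ball n) φ) : x ≠ (HP.chart 0).symm 0 := by
  rintro rfl
  exact hx ⟨0, ⟨Metric.mem_closedBall_self zero_le_one, fun h => h.2.1 rfl⟩, rfl⟩

theorem exists_diffeomorph_blowUpTarget (φ : CoordBall (Hn n) M p) :
    ∃ e : Diffeomorph 𝓘(ℝ, Hn n) 𝓘(ℝ, Hn n) (blowUpTarget φ.toCenteredChart)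
      (side (HP.ball n) φ) ∞, ∀ y, (e y : HP n) = y.1.toHP := by
  obtain ⟨e, he⟩ := exists_diffeomorph_of_restrict (E := Hn n)
    (fun y : blowUpTarget φ.toCenteredChart =>
      (⟨y.1.toHP, (toHP_mem_side_iff φ).2 y.2⟩ : side (HP.ball n) φ))
    -- The point `y` only serves as the junk value of the inverse at the center; none can be fixed
    -- in advance, because `Bl 0` is empty.
    (fun y => ⟨Bl.equivHP y.1, subset_univ _, Bl.contMDiff_toHP.contMDiffOn,
      fun x hx => (Bl.contMDiffAt_ofHP y.1 hx).contMDiffWithinAt, fun _ => rfl⟩)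
    (by
      rintro ⟨x, hx⟩
      obtain ⟨z, hz, h, rfl⟩ := Bl.exists_tail_ne_zero (ne_center_of_mem_side φ hx)
      have hz' := Bl.toHP_ofVec hz h
      exact ⟨⟨Bl.ofVec z h, (toHP_mem_side_iff φ).1 (hz' ▸ hx)⟩, Subtype.ext hz'⟩)
  exact ⟨e, fun x => by rw [he]⟩

variable [T2Space M]

/-- The chart of `HP.ball n` has target `univ`, so its condition on the overlap is void and `0` is
the only vector of the closed ball that is left out. -/
theorem mem_side_ball_iff (φ : CoordBall (Hn n) M p) {x : M} :
    x ∈ side φ (HP.ball n) ↔ x ≠ p := by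
  have h : Metric.closedBall 0 1 \ (overlap φ (HP.ball n) : Set (Hn n)) = {0} := by
    ext y
    constructor
    · rintro ⟨hy, hy'⟩
      by_contra h
      exact hy' ⟨φ.closedBall_subset hy, h, mem_univ _⟩
    · rintro rfl
      exact ⟨Metric.mem_closedBall_self zero_le_one, fun h => h.2.1 rfl⟩
  change x ∉ φ.chart.symm '' _ ↔ _
  rw [h, image_singleton, φ.symm_zero]
  rfl

theorem exists_diffeomorph_side (φ : CoordBall (Hn n) M p) :
    ∃ e : Diffeomorph 𝓘(ℝ, Hn n) 𝓘(ℝ, Hn n) (side φ (HP.ball n)) (punctured p) ∞,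
      ∀ x, (e x : M) = x := by
  obtain ⟨e, he⟩ := exists_diffeomorph_of_restrict (E := Hn n)
    (fun x : side φ (HP.ball n) => (⟨x, (mem_side_ball_iff φ).1 x.2⟩ : punctured p))
    (fun _ => ⟨OpenPartialHomeomorph.refl _, subset_univ _, contMDiffOn_id, contMDiffOn_id,
      fun _ => rfl⟩)
    fun x => ⟨⟨x, (mem_side_ball_iff φ).2 x.2⟩, rfl⟩
  exact ⟨e, fun x => by rw [he]⟩

/-- The identification in the connected sum with `ℍℙⁿ` is the one in the blow-up. -/
theorem connectedSum_inl_eq_inr_iff [IsManifold 𝓘(ℝ, Hn n) ∞ M] (φ : CoordBall (Hn n) M p)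
    {x : side φ (HP.ball n)} {x' : punctured p} {y : blowUpTarget φ.toCenteredChart}
    {y' : side (HP.ball n) φ} (hx : (x' : M) = x) (hy : (y' : HP n) = y.1.toHP) :
    (connectedSumGluing φ (HP.ball n)).inl x = (connectedSumGluing φ (HP.ball n)).inr y' ↔
      (blowUpGluing φ.toCenteredChart).inl x' = (blowUpGluing φ.toCenteredChart).inr y := by
  rw [SmoothGluing.inl_eq_inr_iff, SmoothGluing.inl_eq_inr_iff]
  constructor
  · rintro ⟨⟨w, hw⟩, rfl, rfl⟩
    change (HP.chart 0).symm (ConnectedSum.inv w) = _ at hy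
    -- A glued point of `ℍℙⁿ` lies in chart `0`, hence not at infinity.
    have h0 : y.1.π₁ ≠ 0 := fun h => Bl.toHP_ne_of_π₁_eq_zero h _ hy
    rw [Bl.toHP_of_π₁_ne_zero h0] at hy
    -- Chart `0` is injective and inversion is an involution, so equal points `[1 : w / |w|²]` and
    -- `[1 : v / |v|²]` force `w = v`.
    have hw' : w = y.1.π₁ := by
      rw [← ConnectedSum.inv_inv w, (HP.chart 0).symm.injOn (mem_univ _) (mem_univ _) hy,
        ConnectedSum.inv_inv]
    refine ⟨⟨y.1, y.2, h0⟩, Subtype.ext ?_, rfl⟩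
    refine Eq.trans ?_ hx.symm
    change φ.chart.symm y.1.π₁ = φ.chart.symm w
    rw [hw']
  · rintro ⟨⟨w, hw⟩, rfl, rfl⟩
    refine ⟨⟨w.π₁, hw.1, hw.2, mem_univ _⟩, Subtype.ext hx, Subtype.ext ?_⟩
    exact (Bl.toHP_of_π₁_ne_zero hw.2).symm.trans hy.symm

end

theorem mainTheorem2 (n : ℕ) (M : Type*) [TopologicalSpace M] [T2Space M]
    [ChartedSpace (Hn n) M] [IsManifold 𝓘(ℝ, Hn n) ∞ M] (p : M) :
    Nonempty (CoordBall (Hn n) M p) ∧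
    ∀ φ : CoordBall (Hn n) M p,
      Nonempty (Diffeomorph 𝓘(ℝ, Hn n) 𝓘(ℝ, Hn n)
        (ConnectedSum φ (HP.ball n)) (BlowUp φ.toCenteredChart) ∞) := by
  refine ⟨nonempty_coordBall (Hn n) p, fun φ => ?_⟩
  obtain ⟨f, hf⟩ := exists_diffeomorph_side φ
  obtain ⟨g, hg⟩ := exists_diffeomorph_blowUpTarget φ
  refine ⟨SmoothGluing.congr _ _ f g.symm fun a b => ?_⟩
  exact connectedSum_inl_eq_inr_iff φ (hf a) (by rw [← hg, g.apply_symm_apply])
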